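/- **Theorem.** In online bipartite matching, a finite set $L$ of offline vertices is known in advance and $n$ online vertices arrive one by one, each together with its neighbourhood in $L$. On the arrival of an online vertex the algorithm irrevocably either matches it to a neighbour that is still free or leaves it unmatched. Consider only instances in which every online vertex has degree at most $2$. A randomized online algorithm (a probability distribution on deterministic online algorithms, which may depend on $|L|$ and $n$) is called $c$-competitive if on every such instance the expected size of its matching is at least $c$ times the size of a maximum matching. Let $$\eta := 1-\sum_{i=1}^{\infty}\frac{1}{2^{\,2^i+i-1}} .$$ 1. The Half-Half algorithm is $\eta$-competitive. On the arrival of an online vertex, this algorithm does nothing if there is no free neighbour, matches the vertex to its free neighbour if there is exactly one, and, if there are two free neighbours, matches it to one of them chosen by an independent fair coin flip. 2. For every $c>\eta$, no randomized (in particular, no deterministic) online algorithm is $c$-competitive. 3. $|\eta-0.717772|<5\cdot 10^{-7}$. 4. The optimal ratio is strictly larger for fractional matching on the same instances. There, on the arrival of an online vertex $j$, a deterministic algorithm irrevocably assigns weights $x_{ij}\ge 0$ to the edges at $j$, subject to $\sum_i x_{ij}\le 1$ for every $j$ and $\sum_j x_{ij}\le 1$ for every $i\in L$, and it is $c$-competitive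 if on every instance $\sum_{i,j}x_{ij}$ is at least $c$ times the size of a maximum matching. There is a $\tfrac34$-competitive fractional online algorithm, for $c>\tfrac34$ there is no $c$-competitive one, and $\eta<\tfrac34$. -/

import Mathlib

namespace OnlineMatching

/-- An instance of online bipartite matching with `m` offline vertices `Fin m` (known in advance) and
`n` online vertices `Fin n`, arriving in the order `0, 1, …, n - 1`.  The online vertex `j` arrives
together with its neighbourhood `nbhd j`, which has at most two elements. -/
@[ext]
structure Instance (m n : ℕ) where
  nbhd : Fin n → Finset (Fin m)
  degree_le_two : ∀ j, (nbhd j).card ≤ 2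

/-- Two instances look the same up to and including the arrival of the online vertex `j`. -/
def Instance.AgreeUpTo {m n : ℕ} (G H : Instance m n) (j : Fin n) : Prop :=
  ∀ k, k ≤ j → G.nbhd k = H.nbhd k

/-- `M` assigns to each online vertex a partner (`some i`) or leaves it unmatched (`none`).  It is a
matching of `G` if it uses only edges of `G` and no offline vertex is used twice. -/
def IsMatching {m n : ℕ} (G : Instance m n) (M : Fin n → Option (Fin m)) : Prop :=
  (∀ j i, M j = some i → i ∈ G.nbhd j) ∧
  (∀ j k i, M j = some i → M k = some i → j = k)

/-- The number of edges of a matching. -/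
def size {m n : ℕ} (M : Fin n → Option (Fin m)) : ℕ :=
  (Finset.univ.filter fun j => (M j).isSome).card

open Classical in
/-- The size of a maximum matching of `G`. -/
noncomputable def opt {m n : ℕ} (G : Instance m n) : ℕ :=
  (Finset.univ.filter fun M : Fin n → Option (Fin m) => IsMatching G M).sup size

/-- A deterministic online algorithm for instances with `m` offline and `n` online vertices (it may
depend on `m` and `n`): it always outputs a matching, and the irrevocable decision on the online
vertex `j` depends only on what has been revealed when `j` arrives. -/
@[ext]
structure DetAlgorithm (m n : ℕ) where
  run : Instance m n → Fin n → Option (Fin m)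
  isMatching : ∀ G, IsMatching G (run G)
  online : ∀ G H j, G.AgreeUpTo H j → run G j = run H j

/-- A randomized online algorithm is a probability distribution on deterministic online algorithms.
(For fixed `m` and `n` there are only finitely many of these, so discrete distributions suffice.) -/
abbrev RandAlgorithm (m n : ℕ) := PMF (DetAlgorithm m n)

/-- The distribution of the matching produced by `A` on the instance `G`. -/
noncomputable def RandAlgorithm.output {m n : ℕ} (A : RandAlgorithm m n) (G : Instance m n) :
    PMF (Fin n → Option (Fin m)) :=
  A.map fun D => D.run G

/-- The expected size of the matching produced by `A` on the instance `G`. -/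
noncomputable def RandAlgorithm.expectedSize {m n : ℕ} (A : RandAlgorithm m n) (G : Instance m n) :
    ℝ :=
  ∑ M : Fin n → Option (Fin m), (A.output G M).toReal * (size M : ℝ)

/-- `A` (one randomized online algorithm for each number of offline and online vertices) is
`c`-competitive: on every instance the expected size of its matching is at least `c` times the
optimum. -/
def IsCompetitive (c : ℝ) (A : ∀ m n : ℕ, RandAlgorithm m n) : Prop :=
  ∀ (m n : ℕ) (G : Instance m n), c * (opt G : ℝ) ≤ (A m n).expectedSize G

/-- The choice of Half-Half on the set `free` of free neighbours: no match if it is empty, otherwise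
its smaller or its larger element according to a coin flip.  For one free neighbour the coin is
irrelevant; for two free neighbours a fair coin gives each of them with probability one half. -/
def halfHalfChoice {m : ℕ} (coin : Bool) (free : Finset (Fin m)) : Option (Fin m) :=
  if h : free.Nonempty then some (if coin then free.min' h else free.max' h) else none

/-- The set of offline vertices matched by Half-Half after the first `t` arrivals, where `coin j` is
the coin flipped for the online vertex `j`. -/
def halfHalfUsed {m n : ℕ} (coin : Fin n → Bool) (G : Instance m n) : ℕ → Finset (Fin m)
  | 0 => ∅
  | t + 1 =>
    if h : t < n then
      halfHalfUsed coin G t ∪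
        (halfHalfChoice (coin ⟨t, h⟩) (G.nbhd ⟨t, h⟩ \ halfHalfUsed coin G t)).toFinset
    else halfHalfUsed coin G t

/-- The decision of Half-Half on the online vertex `j`. -/
def halfHalfRun {m n : ℕ} (coin : Fin n → Bool) (G : Instance m n) (j : Fin n) :
    Option (Fin m) :=
  halfHalfChoice (coin j) (G.nbhd j \ halfHalfUsed coin G j)

theorem halfHalfChoice_mem {m : ℕ} {coin : Bool} {free : Finset (Fin m)} {i : Fin m}
    (h : halfHalfChoice coin free = some i) : i ∈ free := by
  unfold halfHalfChoice at h
  split_ifs at h with h1 h2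
  · rw [← Option.some.inj h]; exact Finset.min'_mem _ _
  · rw [← Option.some.inj h]; exact Finset.max'_mem _ _

theorem halfHalfUsed_succ {m n : ℕ} (coin : Fin n → Bool) (G : Instance m n) (j : Fin n) :
    halfHalfUsed coin G (j + 1) =
      halfHalfUsed coin G j ∪ (halfHalfRun coin G j).toFinset := by
  simp [halfHalfUsed, halfHalfRun]

theorem halfHalfUsed_mono {m n : ℕ} (coin : Fin n → Bool) (G : Instance m n) :
    Monotone (halfHalfUsed coin G) := by
  refine monotone_nat_of_le_succ fun t => ?_
  rw [halfHalfUsed]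
  split_ifs
  · exact Finset.subset_union_left
  · exact le_rfl

theorem halfHalfRun_notMem {m n : ℕ} {coin : Fin n → Bool} {G : Instance m n} {j k : Fin n}
    (hjk : j < k) {i : Fin m} (hj : halfHalfRun coin G j = some i) :
    halfHalfRun coin G k ≠ some i := by
  intro hk
  have h1 : i ∈ halfHalfUsed coin G (j + 1) := by
    rw [halfHalfUsed_succ, hj]; simp
  exact (Finset.mem_sdiff.1 (halfHalfChoice_mem hk)).2
    (halfHalfUsed_mono coin G (Nat.succ_le_of_lt hjk) h1)

theorem halfHalfUsed_congr {m n : ℕ} (coin : Fin n → Bool) (G H : Instance m n) (t : ℕ)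
    (h : ∀ k : Fin n, (k : ℕ) < t → G.nbhd k = H.nbhd k) :
    halfHalfUsed coin G t = halfHalfUsed coin H t := by
  induction t with
  | zero => rfl
  | succ t ih =>
    have ih' := ih fun k hk => h k (Nat.lt_succ_of_lt hk)
    by_cases ht : t < n
    · simp only [halfHalfUsed, ht, dite_true, ih', h ⟨t, ht⟩ (Nat.lt_succ_self t)]
    · simp only [halfHalfUsed, ht, dite_false, ih']

/-- Half-Half with a fixed sequence of coin flips. -/
def halfHalfDet {m n : ℕ} (coin : Fin n → Bool) : DetAlgorithm m n where
  run := halfHalfRun coin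
  isMatching G := by
    refine ⟨fun j i h => (Finset.mem_sdiff.1 (halfHalfChoice_mem h)).1, fun j k i hj hk => ?_⟩
    rcases lt_trichotomy j k with h | h | h
    · exact absurd hk (halfHalfRun_notMem h hj)
    · exact h
    · exact absurd hj (halfHalfRun_notMem h hk)
  online G H j h := by
    have h1 := halfHalfUsed_congr coin G H j fun k hk => h k (le_of_lt hk)
    simp only [halfHalfRun, h1, h j le_rfl]

/-- The Half-Half algorithm: a free neighbour is chosen whenever there is one, and by an independent
fair coin flip when there are two. -/
noncomputable def halfHalf (m n : ℕ) : RandAlgorithm m n :=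
  (PMF.uniformOfFintype (Fin n → Bool)).map halfHalfDet

/-- `η = 1 - ∑_{i ≥ 1} 2 ^ (-(2 ^ i + i - 1))`; the summation index is shifted by one. -/
noncomputable def eta : ℝ := 1 - ∑' i : ℕ, 1 / (2 : ℝ) ^ (2 ^ (i + 1) + i)

/-- A deterministic online algorithm for fractional matching: `run G j i` is the fraction to which
the edge between the online vertex `j` and the offline vertex `i` is used. -/
structure FracAlgorithm (m n : ℕ) where
  run : Instance m n → Fin n → Fin m → ℝ
  nonneg : ∀ G j i, 0 ≤ run G j i
  supported : ∀ G j i, i ∉ G.nbhd j → run G j i = 0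
  online_sum_le_one : ∀ G j, ∑ i, run G j i ≤ 1
  offline_sum_le_one : ∀ G i, ∑ j, run G j i ≤ 1
  online : ∀ G H j, G.AgreeUpTo H j → run G j = run H j

/-- `A` (one fractional online algorithm for each number of offline and online vertices) is
`c`-competitive: on every instance the total weight of its fractional matching is at least `c` times
the optimum. -/
def FracIsCompetitive (c : ℝ) (A : ∀ m n : ℕ, FracAlgorithm m n) : Prop :=
  ∀ (m n : ℕ) (G : Instance m n), c * (opt G : ℝ) ≤ ∑ j, ∑ i, (A m n).run G j i

end OnlineMatching

/-!
Half-Half: the events that two disjoint sets of offline vertices stay free are negatively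
correlated, so an arriving vertex whose neighbours are free with probabilities `x` and `y` leaves
each of them free with probability at most `x * y / 2`. In a component of the revealed graph that is
a tree and not saturated by an optimal matching, the expected number of free vertices in excess of
`1 - η` per vertex is at most a potential of the probability at any single vertex; outside these
components there is no excess in total. Each of them contains a vertex that the optimal matching
does not use, which bounds their number.

Upper bound: the adversary plays a random knockout tournament on the offline vertices, each online
vertex being adjacent to the two opponents of a game. The losers form a matching of all online
vertices, but whichever opponent an algorithm matches, the loser of a game of height `h` stays free
forever with probability at least `2 ^ (-(2 ^ h - 1))`.

Fractional matching: the same potential argument applies to levelling the free amounts of the two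
neighbours, with free amounts in place of probabilities. Two online vertices suffice for the upper
bound.
-/

namespace OnlineMatching

open Finset
open scoped BigOperators

section Graph

variable {m n : ℕ} {G : Instance m n} {M : Fin n → Option (Fin m)}

theorem eq_pair_of_card_le_two {α : Type*} [DecidableEq α] {s : Finset α} {u v : α} (hs : #s ≤ 2)
    (hu : u ∈ s) (hv : v ∈ s) (huv : u ≠ v) : s = {u, v} :=
  (eq_of_subset_of_card_le (by simp [insert_subset_iff, hu, hv]) (by rwa [card_pair huv])).symm

theorem Instance.nbhd_eq_pair {j : Fin n} {u v : Fin m} (hu : u ∈ G.nbhd j) (hv : v ∈ G.nbhd j)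
    (huv : u ≠ v) : G.nbhd j = {u, v} :=
  eq_pair_of_card_le_two (G.degree_le_two j) hu hv huv

theorem Instance.nbhd_eq_singleton_or_pair {j : Fin n} {u : Fin m} (hu : u ∈ G.nbhd j) :
    G.nbhd j = {u} ∨ ∃ v, u ≠ v ∧ G.nbhd j = {u, v} := by
  by_cases h : ∃ v ∈ G.nbhd j, u ≠ v
  · obtain ⟨v, hv, huv⟩ := h
    exact Or.inr ⟨v, huv, nbhd_eq_pair hu hv huv⟩
  · push Not at h
    exact Or.inl (eq_singleton_iff_unique_mem.2 ⟨hu, fun v hv => (h v hv).symm⟩)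

theorem exists_isMatching_size_eq_opt (G : Instance m n) :
    ∃ M, IsMatching G M ∧ size M = opt G := by
  classical
  have hne : (univ.filter fun M : Fin n → Option (Fin m) => IsMatching G M).Nonempty :=
    ⟨fun _ => none, mem_filter.2 ⟨mem_univ _, by simp, by simp⟩⟩
  obtain ⟨M, hM, h⟩ := exists_mem_eq_sup _ hne size
  exact ⟨M, (mem_filter.1 hM).2, by rw [← h, opt]⟩

theorem IsMatching.size_le_opt (hM : IsMatching G M) : size M ≤ opt G := by
  classical
  rw [opt]
  convert le_sup (f := size) (mem_filter.2 ⟨mem_univ M, hM⟩)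

end Graph

section MatchedBefore

variable {n : ℕ} {α : Type*} [DecidableEq α]

/-- The offline vertices that `M` matches to one of the first `t` online vertices. -/
def matchedBefore (M : Fin n → Option α) (t : ℕ) : Finset α :=
  (univ.filter fun j : Fin n => (j : ℕ) < t).biUnion fun j => (M j).toFinset

theorem mem_matchedBefore {M : Fin n → Option α} {t : ℕ} {x : α} :
    x ∈ matchedBefore M t ↔ ∃ j : Fin n, (j : ℕ) < t ∧ M j = some x := by
  simp [matchedBefore]

@[simp]
theorem matchedBefore_zero (M : Fin n → Option α) : matchedBefore M 0 = ∅ := by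
  simp [matchedBefore]

theorem matchedBefore_succ (M : Fin n → Option α) (j : Fin n) :
    matchedBefore M (j + 1) = matchedBefore M j ∪ (M j).toFinset := by
  ext x
  simp only [mem_union, mem_matchedBefore, Option.mem_toFinset, Option.mem_def, Nat.lt_succ_iff]
  constructor
  · rintro ⟨k, hk, hx⟩
    rcases hk.lt_or_eq with hk | hk
    · exact Or.inl ⟨k, hk, hx⟩
    · exact Or.inr (Fin.ext hk ▸ hx)
  · rintro (⟨k, hk, hx⟩ | hx)
    · exact ⟨k, hk.le, hx⟩
    · exact ⟨j, le_rfl, hx⟩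

theorem matchedBefore_congr {M N : Fin n → Option α} {t : ℕ}
    (h : ∀ j : Fin n, (j : ℕ) < t → M j = N j) : matchedBefore M t = matchedBefore N t := by
  ext x
  simp only [mem_matchedBefore]
  exact exists_congr fun j => and_congr_right fun hj => by rw [h j hj]

theorem IsMatching.card_matchedBefore {m : ℕ} {G : Instance m n} {M : Fin n → Option (Fin m)}
    (hM : IsMatching G M) : #(matchedBefore M n) = size M := by
  rw [matchedBefore, filter_true_of_mem fun j _ => j.isLt, card_biUnion, size, card_filter]
  · refine sum_congr rfl fun j _ => ?_
    cases M j <;> simp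
  · intro j _ k _ hjk
    simp only [disjoint_left, Option.mem_toFinset, Option.mem_def]
    exact fun x hj hk => hjk (hM.2 j k x hj hk)

end MatchedBefore

section UniformProbability

variable {Ω : Type*} [Fintype Ω] {P Q : Ω → Prop}

open Classical in
/-- The probability of the event `P` under the uniform distribution on `Ω`. -/
noncomputable def prob (P : Ω → Prop) : ℝ := 𝔼 ω, if P ω then 1 else 0

theorem prob_nonneg (P : Ω → Prop) : 0 ≤ prob P :=
  expect_nonneg fun ω _ => by split_ifs <;> norm_num

theorem prob_mono (h : ∀ ω, P ω → Q ω) : prob P ≤ prob Q :=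
  expect_le_expect fun ω _ => by
    by_cases hP : P ω
    · simp [hP, h ω hP]
    · rw [if_neg hP]
      split_ifs <;> norm_num

theorem prob_le_one (P : Ω → Prop) : prob P ≤ 1 := by
  rcases isEmpty_or_nonempty Ω with _ | _
  · simp [prob]
  · exact expect_le univ_nonempty fun ω _ => by split_ifs <;> norm_num

theorem prob_eq_zero (h : ∀ ω, ¬P ω) : prob P = 0 := by
  simp [prob, h]

theorem prob_eq_one [Nonempty Ω] (h : ∀ ω, P ω) : prob P = 1 := by
  simp [prob, h]

theorem prob_comp_perm (σ : Equiv.Perm Ω) (P : Ω → Prop) : prob (fun ω => P (σ ω)) = prob P :=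
  Fintype.expect_equiv σ _ _ fun _ => rfl

theorem prob_or_le (P Q : Ω → Prop) : prob (fun ω => P ω ∨ Q ω) ≤ prob P + prob Q := by
  rw [prob, prob, prob, ← expect_add_distrib]
  refine expect_le_expect fun ω _ => ?_
  by_cases hP : P ω <;> by_cases hQ : Q ω <;> simp [hP, hQ]

theorem prob_or_of_disjoint (h : ∀ ω, P ω → ¬Q ω) :
    prob (fun ω => P ω ∨ Q ω) = prob P + prob Q := by
  rw [prob, prob, prob, ← expect_add_distrib]
  refine expect_congr rfl fun ω _ => ?_
  by_cases hP : P ω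
  · simp [hP, h ω hP]
  · by_cases hQ : Q ω <;> simp [hP, hQ]

theorem prob_le_two_mul_of_perm (σ : Equiv.Perm Ω) (h : ∀ ω, P ω → Q ω ∨ Q (σ ω)) :
    prob P ≤ 2 * prob Q :=
  calc
    prob P ≤ prob Q + prob (fun ω => Q (σ ω)) := (prob_mono h).trans (prob_or_le _ _)
    _ = 2 * prob Q := by rw [prob_comp_perm, two_mul]

theorem prob_eq_two_mul_of_perm (σ : Equiv.Perm Ω) (h : ∀ ω, P ω ↔ Q ω ∨ Q (σ ω))
    (hQ : ∀ ω, Q ω → ¬Q (σ ω)) : prob P = 2 * prob Q :=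
  calc
    prob P = prob Q + prob (fun ω => Q (σ ω)) := by rw [← prob_or_of_disjoint hQ, funext_iff.2
      fun ω => propext (h ω)]
    _ = 2 * prob Q := by rw [prob_comp_perm, two_mul]

theorem expect_card_filter {ι : Type*} [Fintype ι] (P : Ω → ι → Prop)
    [∀ ω, DecidablePred (P ω)] :
    𝔼 ω, (#(univ.filter (P ω)) : ℝ) = ∑ i, prob fun ω => P ω i := by
  simp only [prob, card_filter, Nat.cast_sum, Nat.cast_ite, Nat.cast_one, Nat.cast_zero]
  rw [expect_sum_comm]
  congr! 3

end UniformProbability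

section FlipCoin

variable {ι : Type*} [DecidableEq ι]

/-- Reversing the coin `j`: a measure-preserving involution of the space of coin sequences. -/
def flipCoin (j : ι) : Equiv.Perm (ι → Bool) where
  toFun ω := Function.update ω j (!ω j)
  invFun ω := Function.update ω j (!ω j)
  left_inv ω := by simp
  right_inv ω := by simp

@[simp]
theorem flipCoin_apply_self (j : ι) (ω : ι → Bool) : flipCoin j ω j = !ω j := by
  simp [flipCoin]

theorem flipCoin_apply_of_ne {j k : ι} (h : k ≠ j) (ω : ι → Bool) : flipCoin j ω k = ω k := by
  simp [flipCoin, h]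

end FlipCoin

section ExpectedSize

variable {m n : ℕ}

instance : Finite (Instance m n) :=
  Finite.of_injective Instance.nbhd fun _ _ => Instance.ext

instance : Finite (DetAlgorithm m n) :=
  Finite.of_injective DetAlgorithm.run fun _ _ => DetAlgorithm.ext

theorem sum_toReal_map_mul {α β : Type*} [Fintype α] [Fintype β] (P : PMF α) (f : α → β)
    (g : β → ℝ) : ∑ b, (P.map f b).toReal * g b = ∑ a, (P a).toReal * g (f a) := by
  classical
  have hmap (b : β) : (P.map f b).toReal = ∑ a, if b = f a then (P a).toReal else 0 := by
    rw [PMF.map_apply, tsum_fintype, ENNReal.toReal_sum fun a _ => by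
      split_ifs <;> simp [PMF.apply_ne_top]]
    exact sum_congr rfl fun a _ => by split_ifs <;> rfl
  simp only [hmap, sum_mul]
  rw [sum_comm]
  exact sum_congr rfl fun a _ => by simp

theorem sum_toReal_eq_one {α : Type*} [Fintype α] (P : PMF α) : ∑ a, (P a).toReal = 1 := by
  rw [← ENNReal.toReal_sum fun a _ => P.apply_ne_top a, ← tsum_fintype (L := .unconditional α),
    P.tsum_coe, ENNReal.toReal_one]

/-- Yao's principle, for instances drawn uniformly from a finite family. -/
theorem expect_expectedSize_le {Ω : Type*} [Fintype Ω] {G : Ω → Instance m n} {B : ℝ}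
    (h : ∀ D : DetAlgorithm m n, 𝔼 ω, (size (D.run (G ω)) : ℝ) ≤ B) (A : RandAlgorithm m n) :
    𝔼 ω, A.expectedSize (G ω) ≤ B := by
  have := Fintype.ofFinite (DetAlgorithm m n)
  have hA (ω) : A.expectedSize (G ω) = ∑ D, (A D).toReal * size (D.run (G ω)) :=
    sum_toReal_map_mul A _ _
  calc
    𝔼 ω, A.expectedSize (G ω) = ∑ D, (A D).toReal * 𝔼 ω, (size (D.run (G ω)) : ℝ) := by
      simp only [hA, expect_sum_comm, mul_expect]
    _ ≤ ∑ D, (A D).toReal * B := by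
      gcongr
      exact h _
    _ = B := by rw [← sum_mul, sum_toReal_eq_one, one_mul]

end ExpectedSize

section Excess

variable {α : Type*} {φ : ℝ → ℝ} {b : ℝ} {p q : α → ℝ} {e C : Finset α}

/-- The amount by which the weights `p` on `C` exceed the target `b` per vertex. -/
def excess (b : ℝ) (p : α → ℝ) (C : Finset α) : ℝ := ∑ x ∈ C, (p x - b)

/-- A step from the weights `p` to `q`, caused by the arrival of an online vertex with neighbourhood
`e`, that the potential `φ` can pay for: joining the two trees at the ends of `e` costs at most the
weight lost in the step. -/
structure IsPotentialStep (φ : ℝ → ℝ) (e : Finset α) (p q : α → ℝ) : Prop where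
  eq_of_notMem : ∀ x ∉ e, q x = p x
  le_drop : ∀ u ∈ e, p u ≤ ∑ x ∈ e, (p x - q x)
  merge : ∀ u ∈ e, ∀ v ∈ e, u ≠ v → φ (p u) + φ (p v) - ∑ x ∈ e, (p x - q x) ≤ φ (q u)

theorem excess_union [DecidableEq α] {C D : Finset α} (h : Disjoint C D) :
    excess b p (C ∪ D) = excess b p C + excess b p D :=
  sum_union h

theorem IsPotentialStep.excess_of_disjoint (h : IsPotentialStep φ e p q) (hC : Disjoint C e) :
    excess b q C = excess b p C :=
  sum_congr rfl fun x hx => by rw [h.eq_of_notMem x (disjoint_left.1 hC hx)]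

theorem IsPotentialStep.excess_of_subset (h : IsPotentialStep φ e p q) (hC : e ⊆ C) :
    excess b q C = excess b p C - ∑ x ∈ e, (p x - q x) := by
  have hdrop : ∑ x ∈ e, (p x - q x) = ∑ x ∈ C, (p x - q x) :=
    sum_subset hC fun x _ hx => by rw [h.eq_of_notMem x hx, sub_self]
  rw [hdrop, excess, excess, ← sum_sub_distrib]
  exact sum_congr rfl fun x _ => by ring

theorem IsPotentialStep.drop_nonneg (h : IsPotentialStep φ e p q) (hp : ∀ x, 0 ≤ p x) :
    0 ≤ ∑ x ∈ e, (p x - q x) := by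
  rcases e.eq_empty_or_nonempty with rfl | ⟨u, hu⟩
  · simp
  · exact (hp u).trans (h.le_drop u hu)

end Excess

section TreeFamily

variable {α : Type*} [Fintype α] [DecidableEq α] {φ : ℝ → ℝ} {p q : α → ℝ} {e s U : Finset α}
  {𝒯 : Finset (Finset α)}

/-- The invariant of the potential argument. `𝒯` collects the components of the revealed graph that
are trees and that the optimal matching, whose used offline vertices form `U`, does not saturate. -/
structure IsTreeFamily (φ : ℝ → ℝ) (p : α → ℝ) (U : Finset α) (𝒯 : Finset (Finset α)) : Prop where
  pairwiseDisjoint : (𝒯 : Set (Finset α)).PairwiseDisjoint id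
  not_subset_used : ∀ C ∈ 𝒯, ¬C ⊆ U
  excess_le : ∀ C ∈ 𝒯, ∀ w ∈ C, excess (1 - φ 1) p C ≤ φ (p w)
  excess_compl_nonpos : excess (1 - φ 1) p (𝒯.biUnion id)ᶜ ≤ 0

theorem isTreeFamily_singletons (φ : ℝ → ℝ) :
    IsTreeFamily (α := α) φ 1 ∅ (univ.image singleton) where
  pairwiseDisjoint := by
    simp only [Set.PairwiseDisjoint, Set.Pairwise, mem_coe, mem_image, mem_univ, true_and]
    rintro _ ⟨x, rfl⟩ _ ⟨y, rfl⟩ hxy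
    simpa [Function.onFun] using hxy
  not_subset_used := by simp
  excess_le := by simp [excess]
  excess_compl_nonpos := by
    have huniv : ((univ : Finset α).image singleton).biUnion id = univ := by ext; simp
    simp [huniv, excess]

namespace IsTreeFamily

theorem compl_biUnion_erase (h : IsTreeFamily φ p U 𝒯) {C : Finset α} (hC : C ∈ 𝒯) :
    ((𝒯.erase C).biUnion id)ᶜ = C ∪ (𝒯.biUnion id)ᶜ := by
  have hdisj : Disjoint C ((𝒯.erase C).biUnion id) := by
    rw [disjoint_biUnion_right]
    exact fun D hD => h.pairwiseDisjoint hC (mem_of_mem_erase hD) (ne_of_mem_erase hD).symm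
  have hunion : 𝒯.biUnion id = C ∪ (𝒯.erase C).biUnion id := by
    rw [← insert_erase hC, biUnion_insert, erase_insert_eq_erase, erase_idem, id]
  rw [hunion, compl_union, union_inter_distrib_left, union_compl, univ_inter, eq_comm,
    union_eq_right]
  exact subset_compl_iff_disjoint_right.2 hdisj

theorem not_subset_union (h : IsTreeFamily φ p U 𝒯) {C : Finset α} (hC : C ∈ 𝒯)
    (hCs : Disjoint C s) : ¬C ⊆ U ∪ s := fun hCU =>
  h.not_subset_used C hC (hCs.left_le_of_le_sup_right hCU)

theorem excess_le_of_disjoint (h : IsTreeFamily φ p U 𝒯) (hstep : IsPotentialStep φ e p q)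
    {C : Finset α} (hC : C ∈ 𝒯) (hCe : Disjoint C e) {w : α} (hw : w ∈ C) :
    excess (1 - φ 1) q C ≤ φ (q w) := by
  rw [hstep.excess_of_disjoint hCe, hstep.eq_of_notMem w (disjoint_left.1 hCe hw)]
  exact h.excess_le C hC w hw

theorem restrict (h : IsTreeFamily φ p U 𝒯) (hstep : IsPotentialStep φ e p q) (hs : s ⊆ e)
    {𝒯' : Finset (Finset α)} (hsub : 𝒯' ⊆ 𝒯) (hdisj : ∀ C ∈ 𝒯', Disjoint C e)
    (hexcess : excess (1 - φ 1) p (𝒯'.biUnion id)ᶜ ≤ ∑ x ∈ e, (p x - q x)) :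
    IsTreeFamily φ q (U ∪ s) 𝒯' where
  pairwiseDisjoint := h.pairwiseDisjoint.subset (coe_subset.2 hsub)
  not_subset_used C hC := h.not_subset_union (hsub hC) ((hdisj C hC).mono_right hs)
  excess_le C hC _ hw := h.excess_le_of_disjoint hstep (hsub hC) (hdisj C hC) hw
  excess_compl_nonpos := by
    have he : e ⊆ (𝒯'.biUnion id)ᶜ :=
      subset_compl_iff_disjoint_left.2 ((disjoint_biUnion_left _ _ _).2 hdisj)
    rw [hstep.excess_of_subset he]
    linarith

theorem not_union_subset_union (h : IsTreeFamily φ p U 𝒯) (hs : #s ≤ 1) {C D : Finset α}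
    (hC : C ∈ 𝒯) (hD : D ∈ 𝒯) (hCD : C ≠ D) : ¬C ∪ D ⊆ U ∪ s := by
  intro hsub
  obtain ⟨c, hc, hcU⟩ := not_subset.1 (h.not_subset_used C hC)
  obtain ⟨d, hd, hdU⟩ := not_subset.1 (h.not_subset_used D hD)
  have hcs : c ∈ s := (mem_union.1 (hsub (mem_union_left _ hc))).resolve_left hcU
  have hds : d ∈ s := (mem_union.1 (hsub (mem_union_right _ hd))).resolve_left hdU
  exact disjoint_iff_ne.1 (h.pairwiseDisjoint hC hD hCD) c hc d hd (card_le_one.1 hs c hcs d hds)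

theorem excess_union_le (h : IsTreeFamily φ p U 𝒯) {u v : α}
    (hstep : IsPotentialStep φ {u, v} p q) (hφ : ∀ x, φ (p x) ≤ p x) {C D : Finset α}
    (hC : C ∈ 𝒯) (hD : D ∈ 𝒯) (hCD : C ≠ D) (hu : u ∈ C) (hv : v ∈ D) {w : α} (hw : w ∈ C) :
    excess (1 - φ 1) q (C ∪ D) ≤ φ (q w) := by
  have hdisj : Disjoint C D := h.pairwiseDisjoint hC hD hCD
  have huv : u ≠ v := disjoint_iff_ne.1 hdisj u hu v hv
  rw [hstep.excess_of_subset (by simp [insert_subset_iff, hu, hv]), excess_union hdisj]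
  by_cases hwu : w = u
  · subst hwu
    linarith [hstep.merge w (by simp) v (by simp) huv, h.excess_le C hC w hu, h.excess_le D hD v hv]
  · have hwv : w ≠ v := disjoint_iff_ne.1 hdisj w hw v hv
    rw [hstep.eq_of_notMem w (by simp [hwu, hwv])]
    linarith [h.excess_le C hC w hw, h.excess_le D hD v hv, hφ v, hstep.le_drop v (by simp)]

theorem merge (h : IsTreeFamily φ p U 𝒯) {u v : α} (hstep : IsPotentialStep φ {u, v} p q)
    (hφ : ∀ x, φ (p x) ≤ p x) (hs : s ⊆ {u, v}) (hs1 : #s ≤ 1) {C D : Finset α} (hC : C ∈ 𝒯)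
    (hD : D ∈ 𝒯) (hCD : C ≠ D) (hu : u ∈ C) (hv : v ∈ D) :
    IsTreeFamily φ q (U ∪ s) (insert (C ∪ D) ((𝒯.erase C).erase D)) := by
  have hdisj {E : Finset α} (hE : E ∈ (𝒯.erase C).erase D) : Disjoint E C ∧ Disjoint E D := by
    simp only [mem_erase] at hE
    exact ⟨h.pairwiseDisjoint hE.2.2 hC hE.2.1, h.pairwiseDisjoint hE.2.2 hD hE.1⟩
  have hE𝒯 {E : Finset α} (hE : E ∈ (𝒯.erase C).erase D) : E ∈ 𝒯 :=
    mem_of_mem_erase (mem_of_mem_erase hE)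
  have huv {E : Finset α} (hE : E ∈ (𝒯.erase C).erase D) : Disjoint E {u, v} := by
    simp [disjoint_right.1 (hdisj hE).1 hu, disjoint_right.1 (hdisj hE).2 hv]
  have hunion : (insert (C ∪ D) ((𝒯.erase C).erase D)).biUnion id = 𝒯.biUnion id := by
    conv_rhs => rw [← insert_erase hC, ← insert_erase (mem_erase.2 ⟨hCD.symm, hD⟩)]
    simp only [biUnion_insert, id, union_assoc]
  have hsub : {u, v} ⊆ 𝒯.biUnion id := by
    simp only [insert_subset_iff, singleton_subset_iff, mem_biUnion, id]
    exact ⟨⟨C, hC, hu⟩, D, hD, hv⟩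
  refine ⟨?_, ?_, ?_, ?_⟩
  · rw [coe_insert, Set.pairwiseDisjoint_insert]
    refine ⟨h.pairwiseDisjoint.subset fun E hE => hE𝒯 hE, fun E hE _ => ?_⟩
    exact disjoint_union_left.2 ⟨(hdisj hE).1.symm, (hdisj hE).2.symm⟩
  · refine (forall_mem_insert _ _ _).2 ⟨h.not_union_subset_union hs1 hC hD hCD, fun E hE => ?_⟩
    exact h.not_subset_union (hE𝒯 hE) ((huv hE).mono_right hs)
  · refine (forall_mem_insert _ _ _).2 ⟨fun w hw => ?_, fun E hE w hw =>
      h.excess_le_of_disjoint hstep (hE𝒯 hE) (huv hE) hw⟩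
    rcases mem_union.1 hw with hw | hw
    · exact h.excess_union_le hstep hφ hC hD hCD hu hv hw
    · rw [union_comm]
      exact h.excess_union_le (pair_comm u v ▸ hstep) hφ hD hC hCD.symm hv hu hw
  · rw [hunion, hstep.excess_of_disjoint (disjoint_compl_left_iff.2 hsub)]
    exact h.excess_compl_nonpos

theorem exists_step (h : IsTreeFamily φ p U 𝒯) (hstep : IsPotentialStep φ e p q)
    (hp : ∀ x, 0 ≤ p x) (hφ : ∀ x, φ (p x) ≤ p x) (he : #e ≤ 2) (hs : s ⊆ e) (hs1 : #s ≤ 1) :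
    ∃ 𝒯', IsTreeFamily φ q (U ∪ s) 𝒯' := by
  by_cases hmeet : ∀ C ∈ 𝒯, Disjoint C e
  · exact ⟨𝒯, h.restrict hstep hs Subset.rfl hmeet
      (h.excess_compl_nonpos.trans (hstep.drop_nonneg hp))⟩
  push Not at hmeet
  obtain ⟨C, hC, hCe⟩ := hmeet
  obtain ⟨u, hu, hue⟩ := not_disjoint_iff.1 hCe
  by_cases hmeet' : ∀ D ∈ 𝒯.erase C, Disjoint D e
  · refine ⟨𝒯.erase C, h.restrict hstep hs (erase_subset _ _) hmeet' ?_⟩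
    have hdisj : Disjoint C (𝒯.biUnion id)ᶜ :=
      (subset_biUnion_of_mem id hC).disjoint_compl_right
    rw [h.compl_biUnion_erase hC, excess_union hdisj]
    linarith [h.excess_le C hC u hu, h.excess_compl_nonpos, hφ u, hstep.le_drop u hue]
  push Not at hmeet'
  obtain ⟨D, hD, hDe⟩ := hmeet'
  obtain ⟨v, hv, hve⟩ := not_disjoint_iff.1 hDe
  obtain ⟨hDC, hD⟩ := mem_erase.1 hD
  have huv : u ≠ v := disjoint_iff_ne.1 (h.pairwiseDisjoint hC hD hDC.symm) u hu v hv
  obtain rfl : e = {u, v} := eq_pair_of_card_le_two he hue hve huv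
  exact ⟨_, h.merge hstep hφ hs hs1 hC hD hDC.symm hu hv⟩

theorem card_add_card_le (h : IsTreeFamily φ p U 𝒯) : #𝒯 + #U ≤ Fintype.card α := by
  have hcard : #𝒯 ≤ #(𝒯.biUnion fun C => C \ U) :=
    card_le_card_biUnion (fun C hC D hD hCD => (h.pairwiseDisjoint hC hD hCD).mono
      sdiff_subset sdiff_subset) fun C hC => sdiff_nonempty.2 (h.not_subset_used C hC)
  have hsub : (𝒯.biUnion fun C => C \ U) ⊆ Uᶜ := biUnion_subset.2 fun C _ x hx =>
    mem_compl.2 (mem_sdiff.1 hx).2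
  have := card_add_card_compl U
  have := card_le_card hsub
  omega

theorem mul_card_le (h : IsTreeFamily φ p U 𝒯) (h1 : 0 ≤ φ 1) (hφ1 : ∀ x, φ (p x) ≤ φ 1) :
    φ 1 * #U ≤ Fintype.card α - ∑ x, p x := by
  have hC : ∀ C ∈ 𝒯, excess (1 - φ 1) p C ≤ φ 1 := fun C hC => by
    obtain ⟨w, hw, -⟩ := not_subset.1 (h.not_subset_used C hC)
    exact (h.excess_le C hC w hw).trans (hφ1 w)
  have htotal : ∑ x, p x - Fintype.card α * (1 - φ 1) ≤ #𝒯 * φ 1 :=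
    calc
      ∑ x, p x - Fintype.card α * (1 - φ 1) = excess (1 - φ 1) p univ := by simp [excess, mul_sub]
      _ = ∑ C ∈ 𝒯, excess (1 - φ 1) p C + excess (1 - φ 1) p (𝒯.biUnion id)ᶜ := by
        rw [← union_compl (𝒯.biUnion id), excess_union disjoint_compl_right]
        simp only [excess, sum_biUnion h.pairwiseDisjoint, id]
      _ ≤ ∑ _C ∈ 𝒯, φ 1 + 0 := add_le_add (sum_le_sum hC) h.excess_compl_nonpos
      _ = #𝒯 * φ 1 := by simp
  have hcard : (#𝒯 + #U : ℝ) ≤ Fintype.card α := mod_cast h.card_add_card_le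
  nlinarith [mul_le_mul_of_nonneg_right hcard h1]

end IsTreeFamily

/-- The weight `p t x` is the probability that `x` is free at time `t`, or the fraction of `x` that
is free. -/
theorem mul_opt_le_of_isPotentialStep {m n : ℕ} {G : Instance m n} {φ : ℝ → ℝ}
    {p : ℕ → Fin m → ℝ} (h1 : 0 ≤ φ 1) (hφ : ∀ x, 0 ≤ x → φ x ≤ x)
    (hφ1 : ∀ x, 0 ≤ x → x ≤ 1 → φ x ≤ φ 1) (hp0 : p 0 = 1) (hp : ∀ t x, 0 ≤ p t x ∧ p t x ≤ 1)
    (hstep : ∀ j : Fin n, IsPotentialStep φ (G.nbhd j) (p j) (p (j + 1))) :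
    φ 1 * opt G ≤ m - ∑ x, p n x := by
  obtain ⟨M, hM, hMopt⟩ := exists_isMatching_size_eq_opt G
  have hfamily : ∀ t ≤ n, ∃ 𝒯, IsTreeFamily φ (p t) (matchedBefore M t) 𝒯 := by
    intro t ht
    induction t with
    | zero => exact ⟨_, by rw [hp0, matchedBefore_zero]; exact isTreeFamily_singletons φ⟩
    | succ t ih =>
      obtain ⟨𝒯, h⟩ := ih (by omega)
      lift t to Fin n using ht
      rw [matchedBefore_succ]
      refine h.exists_step (hstep t) (fun x => (hp t x).1) (fun x => hφ _ (hp t x).1)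
        (G.degree_le_two t) (fun i hi => hM.1 t i (Option.mem_toFinset.1 hi)) ?_
      cases M t <;> simp
  obtain ⟨𝒯, h⟩ := hfamily n le_rfl
  have := h.mul_card_le h1 fun x => hφ1 _ (hp n x).1 (hp n x).2
  rwa [hM.card_matchedBefore, hMopt, Fintype.card_fin] at this

end TreeFamily

section LacunarySum

variable {a b q r : ℝ}

/-- The lacunary power series `∑ j, q ^ 2 ^ j / 2 ^ j`, which expresses both `eta` and the potential
for Half-Half. -/
noncomputable def lacunarySum (q : ℝ) : ℝ := ∑' j : ℕ, q ^ 2 ^ j / 2 ^ j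

theorem summable_lacunarySum (hq : 0 ≤ q) (hq1 : q ≤ 1) :
    Summable fun j : ℕ => q ^ 2 ^ j / 2 ^ j := by
  refine summable_geometric_two.of_nonneg_of_le (fun j => by positivity) fun j => ?_
  rw [one_div_pow]
  gcongr
  exact pow_le_one₀ hq hq1

theorem lacunarySum_nonneg (hq : 0 ≤ q) : 0 ≤ lacunarySum q :=
  tsum_nonneg fun j => by positivity

theorem lacunarySum_eq (hq : 0 ≤ q) (hq1 : q ≤ 1) :
    lacunarySum q = q + lacunarySum (q ^ 2) / 2 := by
  rw [lacunarySum, (summable_lacunarySum hq hq1).tsum_eq_zero_add, lacunarySum, ← tsum_div_const]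
  simp only [pow_zero, pow_one, div_one, pow_succ' 2, pow_mul]
  congr! 3 with j
  ring

theorem lacunarySum_le_of_le_mul (hr : 0 ≤ r) (hrab : r ≤ a * b) (ha : 0 ≤ a) (ha1 : a ≤ 1)
    (hb : 0 ≤ b) (hb1 : b ≤ 1) :
    lacunarySum r ≤ (lacunarySum (a ^ 2) + lacunarySum (b ^ 2)) / 2 := by
  have hsr := summable_lacunarySum hr (hrab.trans (mul_le_one₀ ha1 hb hb1))
  have hsa := summable_lacunarySum (sq_nonneg a) (pow_le_one₀ ha ha1)
  have hsb := summable_lacunarySum (sq_nonneg b) (pow_le_one₀ hb hb1)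
  rw [lacunarySum, lacunarySum, lacunarySum, ← hsa.tsum_add hsb, ← tsum_div_const]
  refine hsr.tsum_le_tsum (fun j => ?_) ((hsa.add hsb).div_const 2)
  have hmean : r ^ 2 ^ j ≤ ((a ^ 2) ^ 2 ^ j + (b ^ 2) ^ 2 ^ j) / 2 :=
    calc
      r ^ 2 ^ j ≤ a ^ 2 ^ j * b ^ 2 ^ j := by rw [← mul_pow]; gcongr
      _ ≤ ((a ^ 2 ^ j) ^ 2 + (b ^ 2 ^ j) ^ 2) / 2 := by
        linarith [two_mul_le_add_sq (a ^ 2 ^ j) (b ^ 2 ^ j)]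
      _ = ((a ^ 2) ^ 2 ^ j + (b ^ 2) ^ 2 ^ j) / 2 := by simp only [← pow_mul, mul_comm]
  rw [← add_div, div_right_comm]
  gcongr

theorem lacunarySum_sub_le (ha : 0 ≤ a) (hab : a ≤ b) (hb : b ≤ 1 / 2) :
    lacunarySum b - lacunarySum a ≤ 2 * (b - a) := by
  have hb0 : 0 ≤ b := ha.trans hab
  have hsa := summable_lacunarySum ha (by linarith)
  have hsb := summable_lacunarySum hb0 (by linarith)
  have hterm (j : ℕ) : b ^ 2 ^ j / 2 ^ j - a ^ 2 ^ j / 2 ^ j ≤ (b - a) * (1 / 2) ^ j := by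
    have hpow : b ^ (2 ^ j - 1) ≤ (1 / 2) ^ j :=
      calc
        b ^ (2 ^ j - 1) ≤ (1 / 2) ^ (2 ^ j - 1) := by gcongr
        _ ≤ (1 / 2) ^ j := pow_le_pow_of_le_one (by norm_num) (by norm_num)
          (Nat.le_sub_one_of_lt j.lt_two_pow_self)
    have hdiff : b ^ 2 ^ j - a ^ 2 ^ j ≤ (b - a) * 2 ^ j * b ^ (2 ^ j - 1) := by
      have := (le_abs_self _).trans (abs_pow_sub_pow_le b a (2 ^ j))
      rwa [abs_of_nonneg ha, abs_of_nonneg hb0, abs_of_nonneg (sub_nonneg.2 hab),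
        max_eq_left hab, Nat.cast_pow, Nat.cast_ofNat] at this
    rw [← sub_div, div_le_iff₀ (by positivity)]
    nlinarith [mul_le_mul_of_nonneg_left hpow
      (mul_nonneg (sub_nonneg.2 hab) (pow_nonneg (zero_le_two (α := ℝ)) j))]
  rw [lacunarySum, lacunarySum, ← hsb.tsum_sub hsa, mul_comm]
  exact hasSum_le hterm (hsb.sub hsa).hasSum (hasSum_geometric_two.mul_left (b - a))

theorem eta_eq_one_sub_lacunarySum : eta = 1 - lacunarySum (1 / 4) := by
  rw [eta, lacunarySum]
  congr! 3 with j
  rw [show (1 / 4 : ℝ) = (1 / 2) ^ 2 by norm_num, ← pow_mul, one_div_pow, ← pow_succ', pow_add]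
  field_simp

end LacunarySum

section NumericalValue

theorem hasSum_one_sub_eta :
    HasSum (fun i : ℕ => 1 / (2 : ℝ) ^ (2 ^ (i + 1) + i)) (1 - eta) := by
  have hsum : Summable fun i : ℕ => 1 / (2 : ℝ) ^ (2 ^ (i + 1) + i) := by
    refine summable_geometric_two.of_nonneg_of_le (fun i => by positivity) fun i => ?_
    rw [one_div_pow]
    gcongr
    · norm_num
    · exact Nat.le_add_left _ _
  rw [eta, sub_sub_cancel]
  exact hsum.hasSum

theorem abs_eta_sub_lt : |eta - 0.717772| < 0.0000005 := by
  set a : ℕ → ℝ := fun i => 1 / 2 ^ (2 ^ (i + 1) + i) with ha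
  have hsplit : ∑ i ∈ range 4, a i + ∑' i, a (i + 4) = 1 - eta := by
    rw [hasSum_one_sub_eta.summable.sum_add_tsum_nat_add, hasSum_one_sub_eta.tsum_eq]
  have htail_nonneg : 0 ≤ ∑' i, a (i + 4) := tsum_nonneg fun i => by positivity
  have htail_le : ∑' i, a (i + 4) ≤ 1 / 2 ^ 32 * 2 := by
    refine hasSum_le (fun i => ?_) ((summable_nat_add_iff 4).2 hasSum_one_sub_eta.summable).hasSum
      (hasSum_geometric_two.mul_left _)
    rw [one_div_pow, one_div_mul_one_div, ← pow_add]
    have : 2 ^ 5 ≤ 2 ^ (i + 4 + 1) := Nat.pow_le_pow_right two_pos (by omega)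
    exact one_div_le_one_div_of_le (by positivity) (pow_le_pow_right₀ one_le_two (by omega))
  norm_num [ha, sum_range_succ] at hsplit htail_nonneg htail_le ⊢
  rw [abs_lt]
  constructor <;> linarith

theorem eta_pos : 0 < eta := by
  have := (abs_lt.1 abs_eta_sub_lt).1
  norm_num at this
  linarith

theorem eta_lt_three_quarters : eta < 3 / 4 := by
  have := (abs_lt.1 abs_eta_sub_lt).2
  norm_num at this
  linarith

end NumericalValue

section HalfHalfRun

variable {m n : ℕ} {G : Instance m n} {ω : Fin n → Bool} {j : Fin n} {u v i : Fin m}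

theorem halfHalfRun_mem_sdiff (h : halfHalfRun ω G j = some i) :
    i ∈ G.nbhd j \ halfHalfUsed ω G j :=
  halfHalfChoice_mem h

theorem exists_halfHalfRun_eq_some (hu : u ∈ G.nbhd j) (hfree : u ∉ halfHalfUsed ω G j) :
    ∃ i, halfHalfRun ω G j = some i :=
  ⟨_, dif_pos ⟨u, mem_sdiff.2 ⟨hu, hfree⟩⟩⟩

theorem halfHalfRun_pair (hn : G.nbhd j = {u, v}) (hu : u ∉ halfHalfUsed ω G j)
    (hv : v ∉ halfHalfUsed ω G j) :
    halfHalfRun ω G j = some (if ω j then min u v else max u v) := by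
  have hfree : G.nbhd j \ halfHalfUsed ω G j = {u, v} := by
    rw [hn, Finset.sdiff_eq_self_iff_disjoint]
    simp [hu, hv]
  have hne : ({u, v} : Finset (Fin m)).Nonempty := insert_nonempty u {v}
  rw [halfHalfRun, hfree, halfHalfChoice, dif_pos hne, min'_insert u {v} (singleton_nonempty v),
    max'_insert u {v} (singleton_nonempty v), min'_singleton, max'_singleton]

theorem halfHalfUsed_flipCoin (G : Instance m n) (ω : Fin n → Bool) {j : Fin n} {t : ℕ}
    (ht : t ≤ j) : halfHalfUsed (flipCoin j ω) G t = halfHalfUsed ω G t := by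
  induction t with
  | zero => rfl
  | succ t ih =>
    lift t to Fin n using by omega
    have hne : t ≠ j := fun h => by omega
    rw [halfHalfUsed_succ, halfHalfUsed_succ, halfHalfRun, halfHalfRun, ih (by omega),
      flipCoin_apply_of_ne hne]

theorem halfHalfRun_flipCoin (hn : G.nbhd j = {u, v}) (huv : u ≠ v)
    (hu : u ∉ halfHalfUsed ω G j) (hv : v ∉ halfHalfUsed ω G j) :
    halfHalfRun (flipCoin j ω) G j = some v ↔ halfHalfRun ω G j ≠ some v := by
  have hflip := halfHalfUsed_flipCoin G ω (le_refl (j : ℕ))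
  rw [halfHalfRun_pair hn hu hv, halfHalfRun_pair hn (hflip ▸ hu) (hflip ▸ hv),
    flipCoin_apply_self]
  rcases huv.lt_or_gt with h | h <;> cases ω j <;> simp [h.le, huv]

theorem halfHalfUsed_eq_matchedBefore (G : Instance m n) (ω : Fin n → Bool) {t : ℕ}
    (ht : t ≤ n) : halfHalfUsed ω G t = matchedBefore (halfHalfRun ω G) t := by
  induction t with
  | zero => rw [matchedBefore_zero, halfHalfUsed]
  | succ t ih =>
    lift t to Fin n using ht
    rw [halfHalfUsed_succ, matchedBefore_succ, ih t.2.le]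

theorem size_halfHalfRun (G : Instance m n) (ω : Fin n → Bool) :
    size (halfHalfRun ω G) = #(halfHalfUsed ω G n) := by
  rw [halfHalfUsed_eq_matchedBefore G ω le_rfl]
  exact ((halfHalfDet ω).isMatching G).card_matchedBefore.symm

theorem disjoint_halfHalfUsed_succ {S : Finset (Fin m)} :
    Disjoint S (halfHalfUsed ω G (j + 1)) ↔
      Disjoint S (halfHalfUsed ω G j) ∧ ∀ i ∈ S, halfHalfRun ω G j ≠ some i := by
  rw [halfHalfUsed_succ, disjoint_union_right, disjoint_left (t := Option.toFinset _)]
  simp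

theorem disjoint_halfHalfUsed_succ_iff_of_pair {S : Finset (Fin m)} (hn : G.nbhd j = {u, v})
    (hu : u ∈ S) (hv : v ∉ S) :
    Disjoint S (halfHalfUsed ω G (j + 1)) ↔
      Disjoint (insert v S) (halfHalfUsed ω G j) ∧ halfHalfRun ω G j = some v := by
  rw [disjoint_halfHalfUsed_succ, disjoint_insert_left]
  constructor
  · rintro ⟨hS, hrun⟩
    obtain ⟨i, hi⟩ := exists_halfHalfRun_eq_some (by simp [hn]) (disjoint_left.1 hS hu)
    have hfree := mem_sdiff.1 (halfHalfRun_mem_sdiff hi)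
    rw [hn, mem_insert, mem_singleton] at hfree
    obtain rfl := hfree.1.resolve_left fun h => hrun u hu (h ▸ hi)
    exact ⟨⟨hfree.2, hS⟩, hi⟩
  · rintro ⟨⟨-, hS⟩, hrun⟩
    exact ⟨hS, fun i hi h => hv (Option.some.inj (hrun.symm.trans h) ▸ hi)⟩

end HalfHalfRun

section FreeProb

variable {m n : ℕ} {G : Instance m n} {j : Fin n} {S T : Finset (Fin m)} {u v : Fin m}

/-- The probability that Half-Half leaves all vertices of `S` free during the first `t`
arrivals. -/
noncomputable def freeProb (G : Instance m n) (t : ℕ) (S : Finset (Fin m)) : ℝ :=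
  prob fun ω : Fin n → Bool => Disjoint S (halfHalfUsed ω G t)

theorem freeProb_nonneg (G : Instance m n) (t : ℕ) (S : Finset (Fin m)) : 0 ≤ freeProb G t S :=
  prob_nonneg _

theorem freeProb_le_one (G : Instance m n) (t : ℕ) (S : Finset (Fin m)) : freeProb G t S ≤ 1 :=
  prob_le_one _

theorem freeProb_anti (G : Instance m n) (t : ℕ) (h : S ⊆ T) : freeProb G t T ≤ freeProb G t S :=
  prob_mono fun _ hT => hT.mono_left h

@[simp]
theorem freeProb_zero (G : Instance m n) (S : Finset (Fin m)) : freeProb G 0 S = 1 :=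
  prob_eq_one fun _ => disjoint_empty_right S

theorem freeProb_succ_of_disjoint (h : Disjoint S (G.nbhd j)) :
    freeProb G (j + 1) S = freeProb G j S := by
  have hrun (ω) (i) (hi : i ∈ S) : halfHalfRun ω G j ≠ some i := fun hω =>
    disjoint_left.1 h hi (mem_sdiff.1 (halfHalfRun_mem_sdiff hω)).1
  simp only [freeProb, disjoint_halfHalfUsed_succ, and_iff_left (hrun _)]

theorem freeProb_succ_of_subset (hne : (G.nbhd j).Nonempty) (h : G.nbhd j ⊆ S) :
    freeProb G (j + 1) S = 0 := by
  obtain ⟨u, hu⟩ := hne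
  refine prob_eq_zero fun ω hω => ?_
  obtain ⟨hS, hrun⟩ := disjoint_halfHalfUsed_succ.1 hω
  obtain ⟨i, hi⟩ := exists_halfHalfRun_eq_some hu (disjoint_left.1 hS (h hu))
  exact hrun i (h (mem_sdiff.1 (halfHalfRun_mem_sdiff hi)).1) hi

theorem freeProb_succ_of_pair (hn : G.nbhd j = {u, v}) (hu : u ∈ S) (hv : v ∉ S) :
    freeProb G (j + 1) S = freeProb G j (insert v S) / 2 := by
  have huv : u ≠ v := fun h => hv (h ▸ hu)
  rw [eq_div_iff two_ne_zero, mul_comm, eq_comm, freeProb, freeProb]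
  refine prob_eq_two_mul_of_perm (flipCoin j) (fun ω => ?_) fun ω => ?_ <;>
    simp only [disjoint_halfHalfUsed_succ_iff_of_pair hn hu hv, halfHalfUsed_flipCoin G ω le_rfl,
      ← and_or_left]
  · refine (and_iff_left_of_imp fun hS => ?_).symm
    have hfree {x} (hx : x ∈ insert v S) : x ∉ halfHalfUsed ω G j := disjoint_left.1 hS hx
    rw [halfHalfRun_flipCoin hn huv (hfree (mem_insert_of_mem hu)) (hfree (mem_insert_self v S))]
    exact em _
  · rintro ⟨hS, hrun⟩ ⟨-, hflip⟩
    have hfree {x} (hx : x ∈ insert v S) : x ∉ halfHalfUsed ω G j := disjoint_left.1 hS hx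
    exact (halfHalfRun_flipCoin hn huv (hfree (mem_insert_of_mem hu))
      (hfree (mem_insert_self v S))).1 hflip hrun

theorem freeProb_succ_union_le_of_pair (hn : G.nbhd j = {u, v}) (hST : Disjoint S T) (hu : u ∈ S)
    (hvS : v ∉ S) (hvT : v ∉ T)
    (ih : freeProb G j (insert v S ∪ T) ≤ freeProb G j (insert v S) * freeProb G j T) :
    freeProb G (j + 1) (S ∪ T) ≤ freeProb G (j + 1) S * freeProb G (j + 1) T := by
  have huT : u ∉ T := disjoint_left.1 hST hu
  rw [freeProb_succ_of_pair hn (mem_union_left _ hu) (by simp [hvS, hvT]),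
    freeProb_succ_of_pair hn hu hvS, freeProb_succ_of_disjoint (by simp [hn, huT, hvT]),
    ← insert_union]
  linarith

theorem freeProb_union_le (G : Instance m n) {t : ℕ} (ht : t ≤ n) (hST : Disjoint S T) :
    freeProb G t (S ∪ T) ≤ freeProb G t S * freeProb G t T := by
  induction t generalizing S T with
  | zero => simp
  | succ t ih =>
    lift t to Fin n using ht
    replace ih {S T} (hST : Disjoint S T) := ih (S := S) (T := T) t.2.le hST
    by_cases hmeet : Disjoint (S ∪ T) (G.nbhd t)
    · obtain ⟨hS, hT⟩ := disjoint_union_left.1 hmeet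
      rw [freeProb_succ_of_disjoint hmeet, freeProb_succ_of_disjoint hS,
        freeProb_succ_of_disjoint hT]
      exact ih hST
    obtain ⟨u, huST, hu⟩ := not_disjoint_iff.1 hmeet
    by_cases hsub : G.nbhd t ⊆ S ∪ T
    · rw [freeProb_succ_of_subset ⟨u, hu⟩ hsub]
      exact mul_nonneg (freeProb_nonneg _ _ _) (freeProb_nonneg _ _ _)
    obtain ⟨v, hv, hvST⟩ := not_subset.1 hsub
    have hn : G.nbhd t = {u, v} := Instance.nbhd_eq_pair hu hv fun h => hvST (h ▸ huST)
    obtain ⟨hvS, hvT⟩ := not_or.1 (mem_union.not.1 hvST)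
    rcases mem_union.1 huST with huS | huT
    · exact freeProb_succ_union_le_of_pair hn hST huS hvS hvT
        (ih (disjoint_insert_left.2 ⟨hvT, hST⟩))
    · rw [union_comm, mul_comm]
      exact freeProb_succ_union_le_of_pair hn hST.symm huT hvT hvS
        (ih (disjoint_insert_left.2 ⟨hvS, hST.symm⟩))

theorem expectedSize_halfHalf (G : Instance m n) :
    (halfHalf m n).expectedSize G = m - ∑ x, freeProb G n {x} := by
  have hsize (ω : Fin n → Bool) : (size (halfHalfRun ω G) : ℝ) =
      m - #(univ.filter fun x => Disjoint {x} (halfHalfUsed ω G n)) := by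
    rw [size_halfHalfRun, eq_sub_iff_add_eq, ← Nat.cast_add]
    simp only [disjoint_singleton_left, ← mem_compl, filter_univ_mem]
    rw [card_add_card_compl, Fintype.card_fin]
  calc
    (halfHalf m n).expectedSize G = 𝔼 ω, (size (halfHalfRun ω G) : ℝ) := by
      rw [RandAlgorithm.expectedSize, RandAlgorithm.output, halfHalf, PMF.map_comp,
        sum_toReal_map_mul, Fintype.expect_eq_sum_div_card, sum_div]
      simp [PMF.uniformOfFintype_apply, halfHalfDet, div_eq_inv_mul]
    _ = m - ∑ x, freeProb G n {x} := by
      simp only [hsize, expect_sub_distrib, expect_card_filter, Fintype.expect_const, freeProb]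

/-- The potential for Half-Half, as a function of the probability that a vertex is free. -/
noncomputable def halfHalfPotential (x : ℝ) : ℝ := x - lacunarySum (x ^ 2 / 4)

theorem halfHalfPotential_one : halfHalfPotential 1 = eta := by
  rw [halfHalfPotential, eta_eq_one_sub_lacunarySum, one_pow]

theorem halfHalfPotential_le_self (x : ℝ) : halfHalfPotential x ≤ x :=
  sub_le_self x (lacunarySum_nonneg (by positivity))

theorem halfHalfPotential_le_one {x : ℝ} (hx : 0 ≤ x) (hx1 : x ≤ 1) :
    halfHalfPotential x ≤ halfHalfPotential 1 := by
  have := lacunarySum_sub_le (a := x ^ 2 / 4) (b := 1 ^ 2 / 4) (by positivity) (by gcongr)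
    (by norm_num)
  rw [halfHalfPotential, halfHalfPotential]
  nlinarith

theorem halfHalfPotential_merge {x y r : ℝ} (hx : 0 ≤ x) (hx1 : x ≤ 1) (hy : 0 ≤ y) (hy1 : y ≤ 1)
    (hr : 0 ≤ r) (hrxy : r ≤ x * y) :
    halfHalfPotential x + halfHalfPotential y - (x + y - r) ≤ halfHalfPotential (r / 2) := by
  have hmean := lacunarySum_le_of_le_mul (r := r / 4) (a := x / 2) (b := y / 2) (by positivity)
    (by linarith) (by positivity) (by linarith) (by positivity) (by linarith)
  have hr1 : r ≤ 1 := hrxy.trans (mul_le_one₀ hx1 hy hy1)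
  rw [lacunarySum_eq (by positivity) (by linarith)] at hmean
  simp only [halfHalfPotential, div_pow] at hmean ⊢
  norm_num at hmean ⊢
  rw [div_div]
  norm_num
  linarith

theorem isPotentialStep_freeProb (G : Instance m n) (j : Fin n) :
    IsPotentialStep halfHalfPotential (G.nbhd j) (fun x => freeProb G j {x})
      (fun x => freeProb G (j + 1) {x}) := by
  have hpair {u v} (huv : u ≠ v) (hn : G.nbhd j = {u, v}) :
      freeProb G (j + 1) {u} = freeProb G j {u, v} / 2 := by
    rw [freeProb_succ_of_pair hn (mem_singleton_self u) (by simpa using huv.symm), pair_comm]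
  have hdrop {u v} (huv : u ≠ v) (hn : G.nbhd j = {u, v}) :
      ∑ x ∈ G.nbhd j, (freeProb G j {x} - freeProb G (j + 1) {x}) =
        freeProb G j {u} + freeProb G j {v} - freeProb G j {u, v} := by
    have hnv : G.nbhd j = {v, u} := by rw [hn, pair_comm]
    rw [hn, sum_pair huv, hpair huv hn, hpair huv.symm hnv, pair_comm v u]
    ring
  refine ⟨fun x hx => freeProb_succ_of_disjoint (by simpa using hx), fun u hu => ?_,
    fun u hu v hv huv => ?_⟩
  · rcases Instance.nbhd_eq_singleton_or_pair hu with hn | ⟨v, huv, hn⟩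
    · rw [hn, sum_singleton, freeProb_succ_of_subset ⟨u, hu⟩ hn.subset, sub_zero]
    · rw [hdrop huv hn]
      linarith [freeProb_anti G j (S := {v}) (T := {u, v}) (by simp)]
  · have hn := Instance.nbhd_eq_pair hu hv huv
    have hcorr := freeProb_union_le G j.2.le (disjoint_singleton.2 huv)
    rw [hdrop huv hn, hpair huv hn]
    exact halfHalfPotential_merge (freeProb_nonneg _ _ _) (freeProb_le_one _ _ _)
      (freeProb_nonneg _ _ _) (freeProb_le_one _ _ _) (freeProb_nonneg _ _ _) hcorr

theorem isCompetitive_halfHalf : IsCompetitive eta halfHalf := fun m n G => by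
  rw [expectedSize_halfHalf, ← halfHalfPotential_one]
  exact mul_opt_le_of_isPotentialStep (p := fun t x => freeProb G t {x})
    (halfHalfPotential_one ▸ eta_pos.le) (fun x _ => halfHalfPotential_le_self x)
    (fun x => halfHalfPotential_le_one) (funext fun x => freeProb_zero G {x})
    (fun t x => ⟨freeProb_nonneg G t {x}, freeProb_le_one G t {x}⟩)
    (isPotentialStep_freeProb G)

end FreeProb

section Tournament

variable {n : ℕ} {ω : Fin n → Bool} {j k : Fin n} {t v : ℕ}

/-- The offline vertex at node `v` of a random knockout tournament. The leaves `0, …, n` of the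
tournament are the offline vertices; the node `n + 1 + j` is reached by the winner of game `j`, in
which the nodes `2 * j` and `2 * j + 1` meet and the coin `ω j` decides. -/
def winner (ω : Fin n → Bool) (v : ℕ) : Fin (n + 1) :=
  if h : n < v ∧ v - (n + 1) < n then winner ω (Nat.bit (ω ⟨v - (n + 1), h.2⟩) (v - (n + 1)))
  else Fin.ofNat (n + 1) v
termination_by v
decreasing_by
  rw [Nat.bit_val]
  have := Bool.toNat_le (ω ⟨v - (n + 1), h.2⟩)
  omega

/-- The offline vertex eliminated in game `j`. -/
def loser (ω : Fin n → Bool) (j : Fin n) : Fin (n + 1) := winner ω (Nat.bit (!ω j) j)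

/-- The instance in which the online vertex `j` is adjacent to the two opponents of game `j`. -/
def tournament (ω : Fin n → Bool) : Instance (n + 1) n where
  nbhd j := {winner ω (2 * j), winner ω (2 * j + 1)}
  degree_le_two _ := card_le_two

theorem winner_leaf (ω : Fin n → Bool) (hv : v ≤ n) : winner ω v = Fin.ofNat (n + 1) v := by
  rw [winner, dif_neg (by omega)]

theorem winner_game (ω : Fin n → Bool) (j : Fin n) :
    winner ω (n + 1 + j) = winner ω (Nat.bit (ω j) j) := by
  rw [winner, dif_pos (by omega)]
  simp only [Nat.add_sub_cancel_left]

theorem tournament_nbhd (ω : Fin n → Bool) (j : Fin n) :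
    (tournament ω).nbhd j = {winner ω (n + 1 + j), loser ω j} := by
  rw [winner_game, loser, tournament]
  cases ω j <;> simp [Nat.bit_val, pair_comm]

theorem bit_mem_Ico (b : Bool) (j : Fin n) : Nat.bit b j ∈ Set.Ico (2 * j : ℕ) (n + 1 + j) := by
  rw [Nat.bit_val, Set.mem_Ico]
  have := Bool.toNat_le b
  omega

theorem winner_flipCoin_of_lt (ω : Fin n → Bool) (hv : v < n + 1 + j) :
    winner (flipCoin j ω) v = winner ω v := by
  induction v using Nat.strong_induction_on with
  | _ v ih =>
    rcases le_or_gt v n with hleaf | hgame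
    · rw [winner_leaf _ hleaf, winner_leaf _ hleaf]
    · obtain ⟨k, rfl⟩ := Nat.exists_eq_add_of_lt hgame
      lift k to Fin n using by omega
      have hkj : k ≠ j := fun h => by omega
      rw [add_right_comm] at hv ih ⊢
      have hlt := (bit_mem_Ico (ω k) k).2
      rw [winner_game, winner_game, flipCoin_apply_of_ne hkj]
      exact ih _ hlt (hlt.trans hv)

theorem winner_flipCoin (ω : Fin n → Bool) (j : Fin n) :
    winner (flipCoin j ω) (n + 1 + j) = loser ω j := by
  rw [winner_game, flipCoin_apply_self, winner_flipCoin_of_lt ω (bit_mem_Ico _ j).2, loser]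

theorem injOn_winner (ω : Fin n → Bool) (ht : t ≤ n) :
    Set.InjOn (winner ω) (Set.Ico (2 * t) (n + 1 + t)) := by
  induction t with
  | zero =>
    rintro u ⟨-, hu⟩ v ⟨-, hv⟩ huv
    rw [winner_leaf ω (by omega), winner_leaf ω (by omega)] at huv
    simpa [Nat.mod_eq_of_lt hu, Nat.mod_eq_of_lt hv] using congrArg Fin.val huv
  | succ t ih =>
    lift t to Fin n using ht
    have hnew {v} (hv : v ∈ Set.Ico (2 * (t + 1) : ℕ) (n + 1 + t)) :
        winner ω (n + 1 + t) ≠ winner ω v := fun h => by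
      have hbit := ih t.2.le (bit_mem_Ico (ω t) t) ⟨by have := hv.1; omega, hv.2⟩
        (winner_game ω t ▸ h)
      have := Bool.toNat_le (ω t)
      rw [Nat.bit_val] at hbit
      have := hv.1
      omega
    rintro u ⟨hu, hu'⟩ v ⟨hv, hv'⟩ huv
    rcases (show u ≤ n + 1 + t by omega).lt_or_eq with hut | rfl <;>
      rcases (show v ≤ n + 1 + t by omega).lt_or_eq with hvt | rfl
    · exact ih t.2.le ⟨by omega, hut⟩ ⟨by omega, hvt⟩ huv
    · exact absurd huv.symm (hnew ⟨hu, hut⟩)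
    · exact absurd huv (hnew ⟨hv, hvt⟩)
    · rfl

/-- The offline vertices that are still in the tournament after `t` games. -/
def alive (ω : Fin n → Bool) (t : ℕ) : Set (Fin (n + 1)) :=
  winner ω '' Set.Ico (2 * t) (n + 1 + t)

theorem nbhd_subset_alive (ω : Fin n → Bool) (j : Fin n) :
    ((tournament ω).nbhd j : Set (Fin (n + 1))) ⊆ alive ω j := by
  rw [tournament_nbhd, winner_game, coe_pair, Set.pair_subset_iff]
  exact ⟨Set.mem_image_of_mem _ (bit_mem_Ico _ j), Set.mem_image_of_mem _ (bit_mem_Ico _ j)⟩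

theorem alive_succ_subset (ω : Fin n → Bool) (j : Fin n) :
    alive ω (j + 1) ⊆ alive ω j \ {loser ω j} := by
  have hinj := injOn_winner ω j.2.le
  rintro _ ⟨v, ⟨hv, hv'⟩, rfl⟩
  rcases (show v ≤ n + 1 + j by omega).lt_or_eq with hvj | rfl
  · have hmem : v ∈ Set.Ico (2 * j : ℕ) (n + 1 + j) := ⟨by omega, hvj⟩
    refine ⟨Set.mem_image_of_mem _ hmem, fun h => ?_⟩
    have hbit := hinj hmem (bit_mem_Ico _ j) h
    have := Bool.toNat_le (!ω j)
    rw [Nat.bit_val] at hbit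
    omega
  · rw [winner_game]
    refine ⟨Set.mem_image_of_mem _ (bit_mem_Ico _ j), fun h => ?_⟩
    have hbit := hinj (bit_mem_Ico _ j) (bit_mem_Ico _ j) h
    cases hω : ω j <;> simp [hω, Nat.bit_val] at hbit

theorem alive_subset_of_le (ω : Fin n → Bool) {s t : ℕ} (hst : s ≤ t) (ht : t ≤ n) :
    alive ω t ⊆ alive ω s := by
  induction t, hst using Nat.le_induction with
  | base => exact Set.Subset.rfl
  | succ t _ ih =>
    lift t to Fin n using ht
    exact ((alive_succ_subset ω t).trans Set.sdiff_subset).trans (ih t.2.le)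

theorem loser_mem_nbhd (ω : Fin n → Bool) (j : Fin n) : loser ω j ∈ (tournament ω).nbhd j := by
  simp [tournament_nbhd]

theorem loser_notMem_nbhd_of_lt (hjk : j < k) : loser ω j ∉ (tournament ω).nbhd k := fun h =>
  (alive_succ_subset ω j (alive_subset_of_le ω (Nat.succ_le_of_lt hjk) k.2.le
    (nbhd_subset_alive ω k h))).2 rfl

theorem loser_injective (ω : Fin n → Bool) : Function.Injective (loser ω) := by
  refine Function.Injective.of_lt_imp_ne fun j k hjk h => loser_notMem_nbhd_of_lt (ω := ω) hjk ?_
  rw [h]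
  exact loser_mem_nbhd ω k

theorem le_opt_tournament (ω : Fin n → Bool) : n ≤ opt (tournament ω) := by
  have hM : IsMatching (tournament ω) fun j => some (loser ω j) := by
    refine ⟨fun j i h => ?_, fun j k i hj hk => loser_injective ω ?_⟩
    · rw [← Option.some.inj h]
      exact loser_mem_nbhd ω j
    · exact Option.some.inj (hj.trans hk.symm)
  simpa [size] using hM.size_le_opt

end Tournament

section TournamentProb

variable {n : ℕ} (D : DetAlgorithm (n + 1) n) {ω : Fin n → Bool} {j : Fin n} {t v : ℕ}
  {S : Finset ℕ} {f : ℕ → ℝ}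

/-- The offline vertices that `D` matches during the first `t` games of the tournament. -/
def tournamentMatched (ω : Fin n → Bool) (t : ℕ) : Finset (Fin (n + 1)) :=
  matchedBefore (D.run (tournament ω)) t

theorem agreeUpTo_tournament_flipCoin (ω : Fin n → Bool) (j : Fin n) :
    (tournament (flipCoin j ω)).AgreeUpTo (tournament ω) j := fun k hk => by
  rw [Fin.le_def] at hk
  simp only [tournament]
  rw [winner_flipCoin_of_lt ω (by omega), winner_flipCoin_of_lt ω (by omega)]

theorem tournamentMatched_flipCoin (ω : Fin n → Bool) (ht : t ≤ j + 1) :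
    tournamentMatched D (flipCoin j ω) t = tournamentMatched D ω t :=
  matchedBefore_congr fun k hk => D.online _ _ k fun i hi =>
    agreeUpTo_tournament_flipCoin ω j i (hi.trans (Fin.le_def.2 (by omega)))

theorem tournamentMatched_succ (ω : Fin n → Bool) (j : Fin n) :
    tournamentMatched D ω (j + 1) =
      tournamentMatched D ω j ∪ (D.run (tournament ω) j).toFinset :=
  matchedBefore_succ _ j

theorem winner_mem_tournamentMatched_succ_iff (hv : v ∈ Set.Ico (2 * (j + 1) : ℕ) (n + 1 + j)) :
    winner ω v ∈ tournamentMatched D ω (j + 1) ↔ winner ω v ∈ tournamentMatched D ω j := by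
  rw [tournamentMatched_succ, mem_union, or_iff_left]
  intro hrun
  have hv' : v ∈ Set.Ico (2 * (j + 1) : ℕ) (n + 1 + (j + 1)) := ⟨hv.1, hv.2.trans (by omega)⟩
  have hnbhd := (D.isMatching _).1 _ _ (Option.mem_toFinset.1 hrun)
  rw [tournament_nbhd, mem_insert, mem_singleton] at hnbhd
  rcases hnbhd with h | h
  · exact hv.2.ne (injOn_winner ω j.2 hv' ⟨by omega, by omega⟩ h)
  · exact (alive_succ_subset ω j (Set.mem_image_of_mem _ hv')).2 h

theorem winner_notMem_tournamentMatched_or_flipCoin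
    (hj : ∀ b, winner ω (Nat.bit b j) ∉ tournamentMatched D ω j) :
    winner ω (n + 1 + j) ∉ tournamentMatched D ω (j + 1) ∨
      winner (flipCoin j ω) (n + 1 + j) ∉ tournamentMatched D (flipCoin j ω) (j + 1) := by
  have hne : winner ω (n + 1 + j) ≠ loser ω j := fun h =>
    (alive_succ_subset ω j (Set.mem_image_of_mem _ ⟨by omega, by omega⟩)).2 h
  rw [tournamentMatched_flipCoin D ω le_rfl, winner_flipCoin, tournamentMatched_succ]
  simp only [mem_union, winner_game ω j, loser, hj, Option.mem_toFinset, false_or] at hne ⊢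
  by_contra! h
  exact hne (Option.some.inj (h.1.symm.trans h.2))

theorem prob_winner_notMem_le_two_mul (hS : S ⊆ Ico (2 * (j + 1) : ℕ) (n + 1 + j)) :
    (prob fun ω => ∀ v ∈ insert (2 * j : ℕ) (insert (2 * j + 1 : ℕ) S),
      winner ω v ∉ tournamentMatched D ω j) ≤
    2 * prob fun ω => ∀ v ∈ insert (n + 1 + j : ℕ) S,
      winner ω v ∉ tournamentMatched D ω (j + 1) := by
  refine prob_le_two_mul_of_perm (flipCoin j) fun ω hω => ?_
  simp only [forall_mem_insert] at hω ⊢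
  obtain ⟨h0, h1, hfree⟩ := hω
  have hfree' (v) (hv : v ∈ S) : winner ω v ∉ tournamentMatched D ω (j + 1) := by
    rw [winner_mem_tournamentMatched_succ_iff D (by simpa using hS hv)]
    exact hfree v hv
  have hopponents (b : Bool) : winner ω (Nat.bit b j) ∉ tournamentMatched D ω j := by
    cases b <;> simpa [Nat.bit_val]
  refine (winner_notMem_tournamentMatched_or_flipCoin D hopponents).imp
    (fun h => ⟨h, hfree'⟩) fun h => ⟨h, fun v hv => ?_⟩
  rw [winner_flipCoin_of_lt ω (mem_Ico.1 (hS hv)).2, tournamentMatched_flipCoin D ω le_rfl]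
  exact hfree' v hv

theorem prod_insert_game_le (hf : ∀ v, 0 ≤ f v)
    (hf2 : f (n + 1 + j) ≤ f (2 * j) * f (2 * j + 1) / 2)
    (hS : S ⊆ Ico (2 * (j + 1) : ℕ) (n + 1 + j)) :
    ∏ v ∈ insert (n + 1 + j : ℕ) S, f v ≤
      (∏ v ∈ insert (2 * j : ℕ) (insert (2 * j + 1 : ℕ) S), f v) / 2 := by
  have hlow {v : ℕ} (hv : v < 2 * ((j : ℕ) + 1)) : v ∉ S := fun h => by
    have := mem_Ico.1 (hS h)
    omega
  have hgame : n + 1 + (j : ℕ) ∉ S := fun h => (mem_Ico.1 (hS h)).2.ne rfl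
  have h0 : 2 * (j : ℕ) ∉ insert (2 * (j : ℕ) + 1) S := by
    rw [mem_insert, not_or]
    exact ⟨by omega, hlow (by omega)⟩
  rw [prod_insert hgame, prod_insert h0, prod_insert (hlow (by omega))]
  have := mul_le_mul_of_nonneg_right hf2 (prod_nonneg fun v (_ : v ∈ S) => hf v)
  linarith

theorem prod_le_prob_winner_notMem (hf : ∀ v, 0 ≤ f v) (hf1 : ∀ v ≤ n, f v ≤ 1)
    (hf2 : ∀ j : Fin n, f (n + 1 + j) ≤ f (2 * j) * f (2 * j + 1) / 2) (ht : t ≤ n)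
    (hS : S ⊆ Ico (2 * t) (n + 1 + t)) :
    ∏ v ∈ S, f v ≤ prob fun ω => ∀ v ∈ S, winner ω v ∉ tournamentMatched D ω t := by
  induction t generalizing S with
  | zero =>
    rw [prob_eq_one fun ω => by simp [tournamentMatched]]
    refine prod_le_one (fun v _ => hf v) fun v hv => hf1 v ?_
    have := mem_Ico.1 (hS hv)
    omega
  | succ t ih =>
    lift t to Fin n using ht
    have hold {v} (hv : v ∈ S) (hvt : v ≠ n + 1 + t) : v ∈ Ico (2 * (t + 1) : ℕ) (n + 1 + t) := by
      have := mem_Ico.1 (hS hv)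
      exact mem_Ico.2 ⟨this.1, by omega⟩
    have hsub : Ico (2 * (t + 1) : ℕ) (n + 1 + t) ⊆ Ico (2 * t : ℕ) (n + 1 + t) :=
      Ico_subset_Ico_left (by omega)
    by_cases hgame : n + 1 + (t : ℕ) ∈ S
    · obtain ⟨S, hnot, rfl⟩ : ∃ R, n + 1 + (t : ℕ) ∉ R ∧ insert (n + 1 + (t : ℕ)) R = S :=
        ⟨_, notMem_erase _ S, insert_erase hgame⟩
      replace hold : S ⊆ Ico (2 * (t + 1) : ℕ) (n + 1 + t) := fun v hv =>
        hold (mem_insert_of_mem hv) fun h => hnot (h ▸ hv)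
      have hopponents : insert (2 * t : ℕ) (insert (2 * t + 1 : ℕ) S) ⊆
          Ico (2 * t : ℕ) (n + 1 + t) := by
        simp only [insert_subset_iff, mem_Ico]
        exact ⟨by omega, by omega, hold.trans hsub⟩
      have := (ih t.2.le hopponents).trans (prob_winner_notMem_le_two_mul D hold)
      linarith [prod_insert_game_le hf (hf2 t) hold]
    · replace hold {v} (hv : v ∈ S) := hold hv fun h => hgame (h ▸ hv)
      refine (ih t.2.le fun v hv => hsub (hold hv)).trans (prob_mono fun ω hω v hv => ?_)
      rw [winner_mem_tournamentMatched_succ_iff D (by simpa using hold hv)]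
      exact hω v hv

theorem loser_mem_tournamentMatched_iff :
    loser ω j ∈ tournamentMatched D ω n ↔ loser ω j ∈ tournamentMatched D ω (j + 1) := by
  simp only [tournamentMatched, mem_matchedBefore]
  refine exists_congr fun k => and_congr_left fun hk => iff_of_true k.2 ?_
  by_contra! hjk
  exact loser_notMem_nbhd_of_lt (Nat.lt_of_succ_le hjk) ((D.isMatching _).1 _ _ hk)

theorem prob_loser_notMem (j : Fin n) :
    prob (fun ω => loser ω j ∉ tournamentMatched D ω n) =
      prob fun ω => winner ω (n + 1 + j) ∉ tournamentMatched D ω (j + 1) :=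
  calc
    prob (fun ω => loser ω j ∉ tournamentMatched D ω n) =
        prob fun ω => winner (flipCoin j ω) (n + 1 + j) ∉
          tournamentMatched D (flipCoin j ω) (j + 1) := by
      simp only [loser_mem_tournamentMatched_iff, winner_flipCoin,
        tournamentMatched_flipCoin D _ le_rfl]
    _ = prob fun ω => winner ω (n + 1 + j) ∉ tournamentMatched D ω (j + 1) :=
      prob_comp_perm (flipCoin j) fun ω => winner ω (n + 1 + j) ∉ tournamentMatched D ω (j + 1)

theorem size_add_card_filter_loser_notMem_le (ω : Fin n → Bool) :
    size (D.run (tournament ω)) + #(univ.filter fun j => loser ω j ∉ tournamentMatched D ω n) ≤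
      n + 1 := by
  rw [← (D.isMatching _).card_matchedBefore, ← tournamentMatched,
    ← card_image_of_injective _ (loser_injective ω), ← card_union_of_disjoint]
  · exact card_finset_fin_le _
  · simp only [disjoint_right, mem_image, mem_filter, mem_univ, true_and]
    rintro _ ⟨j, hj, rfl⟩
    exact hj

theorem expect_size_tournament_le (hf : ∀ v, 0 ≤ f v) (hf1 : ∀ v ≤ n, f v ≤ 1)
    (hf2 : ∀ j : Fin n, f (n + 1 + j) ≤ f (2 * j) * f (2 * j + 1) / 2) :
    𝔼 ω, (size (D.run (tournament ω)) : ℝ) ≤ n + 1 - ∑ j : Fin n, f (n + 1 + j) := by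
  have hloser (j : Fin n) : f (n + 1 + j) ≤
      prob fun ω => loser ω j ∉ tournamentMatched D ω n := by
    rw [prob_loser_notMem]
    simpa using prod_le_prob_winner_notMem D (S := {n + 1 + (j : ℕ)}) hf hf1 hf2 j.2
      (by simp; omega)
  calc
    𝔼 ω, (size (D.run (tournament ω)) : ℝ) ≤
        𝔼 ω, (n + 1 - #(univ.filter fun j => loser ω j ∉ tournamentMatched D ω n) : ℝ) := by
      refine expect_le_expect fun ω _ => le_sub_iff_add_le.2 ?_
      exact_mod_cast size_add_card_filter_loser_notMem_le D ω
    _ = n + 1 - ∑ j, prob fun ω => loser ω j ∉ tournamentMatched D ω n := by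
      simp only [expect_sub_distrib, expect_card_filter, Fintype.expect_const]
    _ ≤ n + 1 - ∑ j : Fin n, f (n + 1 + j) := by
      gcongr
      exact hloser _

end TournamentProb

section UpperBound

variable {c : ℝ} {A : ∀ m n : ℕ, RandAlgorithm m n} {k : ℕ}

theorem IsCompetitive.mul_le_sub_sum (hA : IsCompetitive c A) (hc : 0 ≤ c) {n : ℕ} {f : ℕ → ℝ}
    (hf : ∀ v, 0 ≤ f v) (hf1 : ∀ v ≤ n, f v ≤ 1)
    (hf2 : ∀ j : Fin n, f (n + 1 + j) ≤ f (2 * j) * f (2 * j + 1) / 2) :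
    c * n ≤ n + 1 - ∑ j : Fin n, f (n + 1 + j) :=
  calc
    c * n ≤ 𝔼 ω : Fin n → Bool, (A (n + 1) n).expectedSize (tournament ω) :=
      le_expect univ_nonempty fun ω _ => calc
        c * n ≤ c * opt (tournament ω) := by
          gcongr
          exact le_opt_tournament ω
        _ ≤ _ := hA _ _ _
    _ ≤ n + 1 - ∑ j : Fin n, f (n + 1 + j) :=
      expect_expectedSize_le (fun D => expect_size_tournament_le D hf hf1 hf2) _

/-- The height of node `v` in the tournament with `2 ^ k` leaves. Numbering the nodes backwards,
from `1` for the final, gives the binary heap numbering, in which the children of `i` are `2 * i`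
and `2 * i + 1`. -/
def nodeHeight (k v : ℕ) : ℕ := k - Nat.log 2 (2 ^ (k + 1) - 1 - v)

theorem nodeHeight_game (k j : ℕ) :
    nodeHeight k (2 ^ k + j) = k - Nat.log 2 (2 ^ k - 1 - j) := by
  rw [nodeHeight]
  congr 2
  omega

theorem nodeHeight_game_eq_succ {j : ℕ} (hj : j < 2 ^ k - 1) (b : Bool) :
    nodeHeight k (2 ^ k + j) = nodeHeight k (Nat.bit b j) + 1 := by
  set i := 2 ^ k - 1 - j with hi
  have hchild : 2 ^ (k + 1) - 1 - Nat.bit b j = Nat.bit (!b) i := by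
    cases b <;> simp only [Nat.bit_val, Bool.not_false, Bool.not_true, Bool.toNat_true,
      Bool.toNat_false] <;> omega
  have hlog : Nat.log 2 (Nat.bit (!b) i) = Nat.log 2 i + 1 := by
    rw [Nat.log_of_one_lt_of_le one_lt_two (by rw [Nat.bit_val]; omega), Nat.bit_div_two]
  have hlt : Nat.log 2 i < k := Nat.log_lt_of_lt_pow (by omega) (by omega)
  rw [nodeHeight_game, ← hi, nodeHeight, hchild, hlog]
  omega

theorem sum_Ico_two_pow_log (g : ℕ → ℝ) (k : ℕ) :
    ∑ i ∈ Ico 1 (2 ^ k), g (Nat.log 2 i) = ∑ l ∈ range k, 2 ^ l * g l := by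
  induction k with
  | zero => simp
  | succ k ih =>
    have hlevel : ∀ i ∈ Ico (2 ^ k) (2 ^ (k + 1)), g (Nat.log 2 i) = g k := fun i hi => by
      rw [Nat.log_eq_of_pow_le_of_lt_pow (mem_Ico.1 hi).1 (mem_Ico.1 hi).2]
    rw [sum_range_succ, ← ih, ← sum_Ico_consecutive _ Nat.one_le_two_pow
      (Nat.pow_le_pow_right two_pos k.le_succ), sum_congr rfl hlevel, sum_const, Nat.card_Ico,
      pow_succ, mul_two, Nat.add_sub_cancel, nsmul_eq_mul, Nat.cast_pow, Nat.cast_ofNat]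

theorem sum_nodeHeight (g : ℕ → ℝ) (k : ℕ) :
    ∑ j : Fin (2 ^ k - 1), g (nodeHeight k (2 ^ k + j)) =
      ∑ h ∈ range k, 2 ^ (k - 1 - h) * g (h + 1) := by
  calc
    ∑ j : Fin (2 ^ k - 1), g (nodeHeight k (2 ^ k + j)) =
        ∑ j ∈ range (2 ^ k - 1), g (k - Nat.log 2 (1 + (2 ^ k - 1 - 1 - j))) := by
      rw [← Fin.sum_univ_eq_sum_range fun j => g (k - Nat.log 2 (1 + (2 ^ k - 1 - 1 - j)))]
      refine sum_congr rfl fun j _ => ?_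
      rw [nodeHeight_game]
      congr 3
      omega
    _ = ∑ i ∈ Ico 1 (2 ^ k), g (k - Nat.log 2 i) := by
      rw [sum_range_reflect (fun i => g (k - Nat.log 2 (1 + i))), sum_Ico_eq_sum_range]
    _ = ∑ l ∈ range k, 2 ^ l * g (k - l) := sum_Ico_two_pow_log (fun l => g (k - l)) k
    _ = ∑ h ∈ range k, 2 ^ (k - 1 - h) * g (h + 1) := by
      rw [← sum_range_reflect]
      refine sum_congr rfl fun h hh => ?_
      have := mem_range.1 hh
      rw [show k - (k - 1 - h) = h + 1 by omega]

theorem half_pow_two_pow_succ_sub_one (h : ℕ) :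
    (1 / 2 : ℝ) ^ (2 ^ (h + 1) - 1) =
      (1 / 2) ^ (2 ^ h - 1) * (1 / 2) ^ (2 ^ h - 1) / 2 := by
  have := Nat.one_le_two_pow (n := h)
  rw [show 2 ^ (h + 1) - 1 = (2 ^ h - 1) + (2 ^ h - 1) + 1 by omega, pow_succ, pow_add, mul_one_div]

theorem IsCompetitive.mul_le_sum_range (hA : IsCompetitive c A) (hc : 0 ≤ c) (k : ℕ) :
    c * (1 - (1 / 2) ^ k) ≤ 1 - ∑ i ∈ range k, 1 / (2 : ℝ) ^ (2 ^ (i + 1) + i) := by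
  set f : ℕ → ℝ := fun v => (1 / 2) ^ (2 ^ nodeHeight k v - 1) with hf
  have hk : 2 ^ k - 1 + 1 = 2 ^ k := Nat.sub_add_cancel Nat.one_le_two_pow
  have hf2 (j : Fin (2 ^ k - 1)) : f (2 ^ k + j) ≤ f (2 * j) * f (2 * j + 1) / 2 := by
    have h0 : nodeHeight k (2 ^ k + j) = nodeHeight k (2 * j) + 1 :=
      nodeHeight_game_eq_succ j.2 false
    have h1 : nodeHeight k (2 ^ k + j) = nodeHeight k (2 * j + 1) + 1 :=
      nodeHeight_game_eq_succ j.2 true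
    have hsame : nodeHeight k (2 * j + 1) = nodeHeight k (2 * j) := by omega
    simp only [hf]
    rw [hsame, h0, half_pow_two_pow_succ_sub_one]
  have hsum : ∑ j : Fin (2 ^ k - 1), f (2 ^ k + j) =
      2 ^ k * ∑ i ∈ range k, 1 / (2 : ℝ) ^ (2 ^ (i + 1) + i) := by
    rw [hf, sum_nodeHeight (fun h => (1 / 2) ^ (2 ^ h - 1)), mul_sum]
    refine sum_congr rfl fun i hi => ?_
    have := mem_range.1 hi
    have := Nat.one_le_two_pow (n := i + 1)
    rw [one_div_pow, mul_one_div, mul_one_div, div_eq_div_iff (by positivity) (by positivity),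
      ← pow_add, ← pow_add]
    congr 1
    omega
  have hbound := hA.mul_le_sub_sum (n := 2 ^ k - 1) (f := f) hc (fun v => by positivity)
    (fun v _ => pow_le_one₀ (by norm_num) (by norm_num)) (by rwa [hk])
  rw [hk, hsum, Nat.cast_sub Nat.one_le_two_pow] at hbound
  push_cast at hbound
  refine le_of_mul_le_mul_left ?_ (pow_pos two_pos k)
  calc
    2 ^ k * (c * (1 - (1 / 2) ^ k)) = c * (2 ^ k - 1) := by
      rw [one_div_pow]
      field_simp
    _ ≤ 2 ^ k * (1 - ∑ i ∈ range k, 1 / (2 : ℝ) ^ (2 ^ (i + 1) + i)) := by linarith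

theorem IsCompetitive.le_eta (hA : IsCompetitive c A) : c ≤ eta := by
  rcases lt_or_ge c 0 with hc | hc
  · exact (hc.trans eta_pos).le
  have hleft : Filter.Tendsto (fun k : ℕ => c * (1 - (1 / 2 : ℝ) ^ k)) Filter.atTop (nhds c) := by
    simpa using ((tendsto_pow_atTop_nhds_zero_of_lt_one (r := (1 / 2 : ℝ)) (by norm_num)
      (by norm_num)).const_sub 1).const_mul c
  have hright := hasSum_one_sub_eta.tendsto_sum_nat.const_sub 1
  rw [sub_sub_cancel] at hright
  exact le_of_tendsto_of_tendsto' hleft hright (hA.mul_le_sum_range hc)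

end UpperBound

section Balance

variable {α : Type*} [DecidableEq α] {s : Finset α} {p : α → ℝ} {u v x : α}

/-- The free amounts after one unit of water has been drawn from the vertices of `s`, at most two,
which had the free amounts `p`: both end at a common level, or empty. -/
noncomputable def balance (s : Finset α) (p : α → ℝ) (x : α) : ℝ :=
  if x ∈ s then max 0 ((∑ y ∈ s, p y - 1) / 2) else p x

theorem balance_of_mem (hx : x ∈ s) : balance s p x = max 0 ((∑ y ∈ s, p y - 1) / 2) :=
  if_pos hx

theorem balance_of_notMem (hx : x ∉ s) : balance s p x = p x :=
  if_neg hx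

theorem balance_nonneg (hp : 0 ≤ p x) : 0 ≤ balance s p x := by
  rw [balance]
  split_ifs
  · exact le_max_left _ _
  · exact hp

omit [DecidableEq α] in
theorem sum_le_card (hp : ∀ y, p y ≤ 1) (s : Finset α) : ∑ y ∈ s, p y ≤ #s := by
  simpa using sum_le_card_nsmul s p 1 fun y _ => hp y

theorem balance_le (hs : #s ≤ 2) (hp : ∀ y, 0 ≤ p y ∧ p y ≤ 1) (x : α) : balance s p x ≤ p x := by
  by_cases hx : x ∈ s
  · have hothers : ∑ y ∈ s.erase x, p y ≤ 1 := (sum_le_card (fun y => (hp y).2) _).trans (by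
      rw [card_erase_of_mem hx]
      exact_mod_cast Nat.sub_le_of_le_add hs)
    rw [balance_of_mem hx, ← add_sum_erase s p hx]
    exact max_le (hp x).1 (by linarith [(hp x).1])
  · exact (balance_of_notMem hx).le

theorem sum_sub_balance (hs : #s ≤ 2) (hp : ∀ y, 0 ≤ p y ∧ p y ≤ 1) :
    ∑ x ∈ s, (p x - balance s p x) = min 1 (∑ x ∈ s, p x) := by
  rw [sum_sub_distrib, sum_congr rfl fun x => balance_of_mem, sum_const, nsmul_eq_mul]
  rcases le_total (∑ y ∈ s, p y) 1 with h | h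
  · rw [max_eq_left (by linarith), min_eq_right h]
    ring
  rw [max_eq_right (by linarith), min_eq_left h]
  rcases hs.lt_or_eq with hs1 | hs2
  · have hs1' : (#s : ℝ) ≤ 1 := mod_cast Nat.le_of_lt_succ hs1
    have hsum : ∑ y ∈ s, p y = 1 := h.antisymm' ((sum_le_card (fun y => (hp y).2) s).trans hs1')
    simp [hsum]
  · rw [hs2, Nat.cast_ofNat]
    ring

/-- The potential for balancing, as a function of the free amount of a vertex. -/
noncomputable def balancePotential (x : ℝ) : ℝ := min x (1 / 4 + x / 2)

theorem balancePotential_one : balancePotential 1 = 3 / 4 := by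
  norm_num [balancePotential]

theorem isPotentialStep_balance (hs : #s ≤ 2) (hp : ∀ y, 0 ≤ p y ∧ p y ≤ 1) :
    IsPotentialStep balancePotential s p (balance s p) where
  eq_of_notMem _ := balance_of_notMem
  le_drop u hu := by
    rw [sum_sub_balance hs hp]
    exact le_min (hp u).2 (single_le_sum (fun y _ => (hp y).1) hu)
  merge u hu v hv huv := by
    have hsum : ∑ y ∈ s, p y = p u + p v := by
      rw [eq_pair_of_card_le_two hs hu hv huv, sum_pair huv]
    rw [sum_sub_balance hs hp, balance_of_mem hu, hsum, sub_le_iff_le_add]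
    have hu1 := hp u
    have hv1 := hp v
    simp only [balancePotential]
    rcases le_total 1 (p u + p v) with h | h
    · rw [min_eq_left h, max_eq_right (by linarith)]
      grind
    · rw [min_eq_right h, max_eq_left (by linarith)]
      grind

end Balance

section Fractional

variable {m n : ℕ} {G H : Instance m n} {c : ℝ}

/-- The free amounts of the offline vertices under balancing after `t` arrivals. -/
noncomputable def fracFree (G : Instance m n) : ℕ → Fin m → ℝ
  | 0 => 1
  | t + 1 => if h : t < n then balance (G.nbhd ⟨t, h⟩) (fracFree G t) else fracFree G t

theorem fracFree_succ (G : Instance m n) (j : Fin n) :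
    fracFree G (j + 1) = balance (G.nbhd j) (fracFree G j) :=
  dif_pos j.2

theorem fracFree_mem_unitInterval (G : Instance m n) (t : ℕ) (x : Fin m) :
    0 ≤ fracFree G t x ∧ fracFree G t x ≤ 1 := by
  induction t generalizing x with
  | zero => simp [fracFree]
  | succ t ih =>
    rw [fracFree]
    split_ifs with ht
    · exact ⟨balance_nonneg (ih x).1, (balance_le (G.degree_le_two _) ih x).trans (ih x).2⟩
    · exact ih x

theorem fracFree_succ_le (G : Instance m n) (j : Fin n) (x : Fin m) :
    fracFree G (j + 1) x ≤ fracFree G j x := by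
  rw [fracFree_succ]
  exact balance_le (G.degree_le_two j) (fracFree_mem_unitInterval G j) x

theorem fracFree_congr {t : ℕ} (h : ∀ k : Fin n, (k : ℕ) < t → G.nbhd k = H.nbhd k) :
    fracFree G t = fracFree H t := by
  induction t with
  | zero => rfl
  | succ t ih =>
    rw [fracFree, fracFree, ih fun k hk => h k (hk.trans t.lt_succ_self)]
    split_ifs with ht
    · rw [h ⟨t, ht⟩ t.lt_succ_self]
    · rfl

theorem sum_sub_fracFree_succ (G : Instance m n) (x : Fin m) :
    ∑ j : Fin n, (fracFree G j x - fracFree G (j + 1) x) = 1 - fracFree G n x := by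
  rw [Fin.sum_univ_eq_sum_range (fun t => fracFree G t x - fracFree G (t + 1) x) n,
    sum_range_sub' (fun t => fracFree G t x), fracFree, Pi.one_apply]

/-- The algorithm that draws from the neighbours of each arriving vertex so as to level their free
amounts. -/
noncomputable def balancing (m n : ℕ) : FracAlgorithm m n where
  run G j x := fracFree G j x - fracFree G (j + 1) x
  nonneg G j x := sub_nonneg.2 (fracFree_succ_le G j x)
  supported G j x hx := by rw [fracFree_succ, balance_of_notMem hx, sub_self]
  online_sum_le_one G j := by
    rw [← sum_subset (subset_univ (G.nbhd j)) fun x _ hx => by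
      rw [fracFree_succ, balance_of_notMem hx, sub_self], fracFree_succ,
      sum_sub_balance (G.degree_le_two j) (fracFree_mem_unitInterval G j)]
    exact min_le_left _ _
  offline_sum_le_one G x := by
    rw [sum_sub_fracFree_succ]
    exact sub_le_self 1 (fracFree_mem_unitInterval G n x).1
  online G H j h := by
    rw [fracFree_congr fun k hk => h k hk.le, fracFree_congr fun k hk => h k (Nat.le_of_lt_succ hk)]

theorem fracIsCompetitive_balancing : FracIsCompetitive (3 / 4) balancing := fun m n G =>
  calc
    3 / 4 * (opt G : ℝ) ≤ m - ∑ x, fracFree G n x := by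
      rw [← balancePotential_one]
      refine mul_opt_le_of_isPotentialStep (p := fracFree G) (by norm_num [balancePotential_one])
        (fun x _ => min_le_left _ _) (fun x _ hx => ?_) rfl (fracFree_mem_unitInterval G)
        fun j => ?_
      · rw [balancePotential_one]
        exact (min_le_right _ _).trans (by linarith)
      · rw [fracFree_succ]
        exact isPotentialStep_balance (G.degree_le_two j) (fracFree_mem_unitInterval G j)
    _ = ∑ j, ∑ i, (balancing m n).run G j i := by
      rw [sum_comm]
      simp only [balancing, sum_sub_fracFree_succ]
      simp

/-- The instance in which first a vertex adjacent to both offline vertices arrives, then one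
adjacent to `i` only. -/
def pendantInstance (i : Fin 2) : Instance 2 2 where
  nbhd := ![univ, {i}]
  degree_le_two j := by fin_cases j <;> simp

theorem two_le_opt_pendantInstance (i : Fin 2) : 2 ≤ opt (pendantInstance i) := by
  have hM : IsMatching (pendantInstance i) fun j => some (![i + 1, i] j) := by
    simp [IsMatching, Fin.forall_fin_two, pendantInstance]
  simpa [size] using hM.size_le_opt

theorem FracIsCompetitive.le_three_quarters {A : ∀ m n : ℕ, FracAlgorithm m n}
    (hA : FracIsCompetitive c A) : c ≤ 3 / 4 := by
  by_contra! hc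
  set D := A 2 2
  have hfirst : D.run (pendantInstance 0) 0 = D.run (pendantInstance 1) 0 :=
    D.online _ _ 0 fun k hk => by simp [Fin.le_zero_iff.1 hk, pendantInstance]
  have htotal (i : Fin 2) : 2 * c ≤ ∑ j, ∑ x, D.run (pendantInstance i) j x := by
    have hopt : (2 : ℝ) ≤ opt (pendantInstance i) := mod_cast two_le_opt_pendantInstance i
    nlinarith [hA 2 2 (pendantInstance i)]
  have htotal0 := htotal 0
  have htotal1 := htotal 1
  have hsupp0 := D.supported (pendantInstance 0) 1 1 (by simp [pendantInstance])
  have hsupp1 := D.supported (pendantInstance 1) 1 0 (by simp [pendantInstance])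
  have hoffline0 := D.offline_sum_le_one (pendantInstance 0) 0
  have hoffline1 := D.offline_sum_le_one (pendantInstance 1) 1
  have honline := D.online_sum_le_one (pendantInstance 1) 0
  simp only [Fin.sum_univ_two, hfirst, hsupp0, hsupp1] at *
  linarith

end Fractional

end OnlineMatching

theorem theorem1 :
    -- Half-Half is `η`-competitive
    OnlineMatching.IsCompetitive OnlineMatching.eta OnlineMatching.halfHalf ∧
    -- no randomized online algorithm is better than `η`-competitive
    (∀ c : ℝ, OnlineMatching.eta < c →
      ¬ ∃ A : ∀ m n : ℕ, OnlineMatching.RandAlgorithm m n, OnlineMatching.IsCompetitive c A) ∧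
    -- numerical value: `η` rounds to `0.717772`
    |OnlineMatching.eta - 0.717772| < 0.0000005 ∧
    -- separation: the optimal competitive ratio of fractional online algorithms is `3 / 4 > η`
    (∃ A : ∀ m n : ℕ, OnlineMatching.FracAlgorithm m n,
      OnlineMatching.FracIsCompetitive (3 / 4) A) ∧
    (∀ c : ℝ, 3 / 4 < c →
      ¬ ∃ A : ∀ m n : ℕ, OnlineMatching.FracAlgorithm m n,
        OnlineMatching.FracIsCompetitive c A) ∧
    OnlineMatching.eta < 3 / 4 :=
  ⟨OnlineMatching.isCompetitive_halfHalf,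
    fun _ hc ⟨_, hA⟩ => hc.not_ge hA.le_eta,
    OnlineMatching.abs_eta_sub_lt,
    ⟨OnlineMatching.balancing, OnlineMatching.fracIsCompetitive_balancing⟩,
    fun _ hc ⟨_, hA⟩ => hc.not_ge hA.le_three_quarters,
    OnlineMatching.eta_lt_three_quarters⟩
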